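/- \textbf{Conventions.} Let $F_n$ be the free group of rank $n$. A subgroup $A\le F_n$ is a free factor if $F_n=A*B$ for some subgroup $B\le F_n$. Let $\mathcal{AF}_n$ be the geometric realisation of the poset of non-trivial proper free factors of $F_n$ ordered by inclusion, and let $\mathcal{OF}_n$ be the geometric realisation of the poset of conjugacy classes $[A]$ of non-trivial proper free factors, where $[A]\le[B]$ if some conjugate of $A$ is contained in $B$. The rank of the vertex $[A]$ is the rank of the free group $A$. Two vertices are adjacent if they are distinct and span an edge. A vertex $[\Lambda]$ of rank $n-1$ and a vertex $[u]$ of rank $1$ of $\mathcal{OF}_n$ are (algebraically) antipodal if there are representatives $\Lambda_0\in[\Lambda]$ and $U_0\in[u]$ with $\Lambda_0*U_0=F_n$. Let $\partial\Delta_{n-1}$ denote the barycentric subdivision of the boundary of the $(n-1)$-simplex, i.e. the geometric realisation of the poset of non-empty proper subsets of $\{0,\dots,n-1\}$. An apartment in $\mathcal{OF}_n$ is the image of a simplicial embedding $\sigma:\partial\Delta_{n-1}\hookrightarrow\mathcal{OF}_n$ such that $\sigma(S)$ has rank $|S|$ for every non-empty proper subset $S$; the vertex opposite $\sigma(\{i\})$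 is $\sigma(\{0,\dots,n-1\}\smallsetminus\{i\})$. A standard apartment in $\mathcal{AF}_n$ is the full subcomplex spanned by the free factors generated by the non-empty proper subsets of some basis of $F_n$; an apartment in $\mathcal{OF}_n$ is standard if it is the image of a standard apartment under the projection $\mathcal{AF}_n\to\mathcal{OF}_n$, $A\mapsto[A]$. \textbf{Proposition.} Let $\Delta$ be an apartment in $\mathcal{OF}_3$ and assume that (1) opposite vertices of $\Delta$ are antipodal, and (2) $\Delta$ has a ``potential stick'' at each rank-2 vertex $V$ of $\Delta$, i.e. there is a rank-1 vertex of $\mathcal{OF}_3$ that is adjacent to $V$ and antipodal to each of the other two rank-2 vertices of $\Delta$. Then $\Delta$ is a standard apartment. -/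

import Mathlib

noncomputable section

/-! ### Simplicial complexes -/

/-- The geometric realisation of a poset, as an abstract simplicial complex: its vertices are the
elements of the poset, its simplices are the nonempty finite chains. -/
def orderComplex (P : Type*) [PartialOrder P] : AbstractSimplicialComplex P where
  faces := {s | s.Nonempty ∧ IsChain (· ≤ ·) (s : Set P)}
  isRelLowerSet_faces := fun {_} hs =>
    ⟨hs.1, fun _ hts ht => ⟨ht, hs.2.mono (by exact_mod_cast hts)⟩⟩
  singleton_mem := fun v => ⟨Finset.singleton_nonempty v, by simp⟩

/-- A simplicial embedding of abstract simplicial complexes: a map which is injective on vertices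
and takes simplices to simplices. -/
structure SimplicialEmbedding {V W : Type*} (K : AbstractSimplicialComplex V)
    (L : AbstractSimplicialComplex W) where
  /-- the map on vertices -/
  toFun : V → W
  injective : Function.Injective toFun
  map_faces : ∀ s ∈ K.faces, open Classical in s.image toFun ∈ L.faces

open Classical in
/-- The image of a simplicial embedding, a subcomplex of the target. -/
def SimplicialEmbedding.image {V W : Type*} {K : AbstractSimplicialComplex V}
    {L : AbstractSimplicialComplex W} (σ : SimplicialEmbedding K L) :
    PreAbstractSimplicialComplex W :=
  K.toPreAbstractSimplicialComplex.map σ.toFun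

/-- Two distinct vertices are adjacent if they span an edge. -/
def AbstractSimplicialComplex.Adjacent {V : Type*} (K : AbstractSimplicialComplex V)
    (v w : V) : Prop :=
  v ≠ w ∧ open Classical in ({v, w} : Finset V) ∈ K.faces

/-- The full subcomplex spanned by a set of vertices. -/
def AbstractSimplicialComplex.fullSubcomplex {V : Type*} (K : AbstractSimplicialComplex V)
    (X : Set V) : PreAbstractSimplicialComplex V where
  faces := {s | s ∈ K.faces ∧ (s : Set V) ⊆ X}
  isRelLowerSet_faces := fun {_} hs =>
    ⟨(K.isRelLowerSet_faces hs.1).1, fun _ hts ht =>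
      ⟨(K.isRelLowerSet_faces hs.1).2 hts ht,
        Set.Subset.trans (by exact_mod_cast hts) hs.2⟩⟩

/-- The nonempty proper subsets of `{0, …, n - 1}`. -/
abbrev ProperFace (n : ℕ) : Type :=
  {S : Finset (Fin n) // S.Nonempty ∧ S ≠ Finset.univ}

/-- The barycentric subdivision of the boundary of the standard `(n - 1)`-simplex. -/
def boundarySimplex (n : ℕ) : AbstractSimplicialComplex (ProperFace n) :=
  orderComplex (ProperFace n)

/-! ### Free factors -/

/-- `G` is the (internal) free product `A * B` of its subgroups `A` and `B`. -/
def IsInternalFreeProduct {G : Type*} [Group G] (A B : Subgroup G) : Prop :=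
  Function.Bijective (Monoid.Coprod.lift A.subtype B.subtype)

/-- `A` is a free factor of `G`. -/
def IsFreeFactor {G : Type*} [Group G] (A : Subgroup G) : Prop :=
  ∃ B : Subgroup G, IsInternalFreeProduct A B

/-- The non-trivial proper free factors of the free group `F_n`, ordered by inclusion. -/
abbrev FreeFactor (n : ℕ) : Type :=
  {A : Subgroup (FreeGroup (Fin n)) // IsFreeFactor A ∧ A ≠ ⊥ ∧ A ≠ ⊤}

/-- The free factor has rank `k`, i.e. it is a free group on `k` generators. -/
def FreeFactor.HasRank {n : ℕ} (A : FreeFactor n) (k : ℕ) : Prop :=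
  Nonempty (FreeGroupBasis (Fin k) A.1)

/-- The complex `𝒜ℱ_n` of free factors. -/
def complexAF (n : ℕ) : AbstractSimplicialComplex (FreeFactor n) :=
  orderComplex (FreeFactor n)

/-- The conjugate subgroup `g A g⁻¹`. -/
def conjSubgroup {G : Type*} [Group G] (g : G) (A : Subgroup G) : Subgroup G :=
  A.map (MulAut.conj g).toMonoidHom

theorem mem_conjSubgroup {G : Type*} [Group G] {g : G} {A : Subgroup G} {x : G} :
    x ∈ conjSubgroup g A ↔ g⁻¹ * x * g ∈ A := by
  constructor
  · rintro ⟨a, ha, rfl⟩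
    simpa [mul_assoc] using ha
  · intro h
    exact ⟨_, h, by simp [mul_assoc]⟩

theorem conjSubgroup_one {G : Type*} [Group G] (A : Subgroup G) : conjSubgroup 1 A = A := by
  ext x
  simp [mem_conjSubgroup]

theorem conjSubgroup_mul {G : Type*} [Group G] (g h : G) (A : Subgroup G) :
    conjSubgroup (g * h) A = conjSubgroup g (conjSubgroup h A) := by
  ext x
  simp [mem_conjSubgroup, mul_assoc]

theorem conjSubgroup_mono {G : Type*} [Group G] (g : G) {A B : Subgroup G} (h : A ≤ B) :
    conjSubgroup g A ≤ conjSubgroup g B :=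
  Subgroup.map_mono h

/-- A conjugate of a free factor that lies in the free factor is equal to it. -/
theorem IsFreeFactor.conj_eq_of_le {G : Type*} [Group G] {A : Subgroup G} (hA : IsFreeFactor A)
    {x : G} (hx : conjSubgroup x A ≤ A) : conjSubgroup x A = A := by
  obtain ⟨B, hB⟩ := hA
  let e := MulEquiv.ofBijective _ hB
  let r : G →* A :=
    (Monoid.Coprod.lift (MonoidHom.id A) (1 : B →* A)).comp e.symm.toMonoidHom
  have hr : ∀ a : A, r a = a := by
    intro a
    have h1 : e.symm (a : G) = Monoid.Coprod.inl a := by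
      rw [MulEquiv.symm_apply_eq]
      exact (Monoid.Coprod.lift_apply_inl A.subtype B.subtype a).symm
    simp [r, h1]
  have key : ∀ a ∈ A, x * a * x⁻¹ = (r x : G) * a * (r x : G)⁻¹ := by
    intro a ha
    have hm : x * a * x⁻¹ ∈ A := hx (mem_conjSubgroup.2 (by simpa [mul_assoc] using ha))
    have h2 := congrArg (Subtype.val) (hr ⟨_, hm⟩)
    have h3 := congrArg (Subtype.val) (hr ⟨a, ha⟩)
    simp only [map_mul, map_inv, Subgroup.coe_mul, Subgroup.coe_inv] at h2 h3
    rw [← h2, h3]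
  refine le_antisymm hx fun y hy => ?_
  have ha : (r x : G)⁻¹ * y * (r x : G) ∈ A :=
    A.mul_mem (A.mul_mem (A.inv_mem (r x).2) hy) (r x).2
  have h4 := key _ ha
  refine ⟨_, ha, ?_⟩
  simpa [mul_assoc] using h4

/-- Conjugacy of free factors. -/
instance conjSetoid (n : ℕ) : Setoid (FreeFactor n) where
  r A B := ∃ g : FreeGroup (Fin n), conjSubgroup g A.1 = B.1
  iseqv :=
    { refl := fun A => ⟨1, conjSubgroup_one _⟩
      symm := by
        rintro A B ⟨g, hg⟩
        exact ⟨g⁻¹, by rw [← hg, ← conjSubgroup_mul, inv_mul_cancel, conjSubgroup_one]⟩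
      trans := by
        rintro A B C ⟨g, hg⟩ ⟨h, hh⟩
        exact ⟨h * g, by rw [conjSubgroup_mul, hg, hh]⟩ }

/-- The conjugacy classes `[A]` of non-trivial proper free factors `A` of `F_n`. -/
def FactorClass (n : ℕ) : Type := Quotient (conjSetoid n)

/-- The class `[A]` of a free factor `A`. -/
def FreeFactor.toClass {n : ℕ} (A : FreeFactor n) : FactorClass n := Quotient.mk _ A

theorem FreeFactor.toClass_eq_iff {n : ℕ} {A B : FreeFactor n} :
    A.toClass = B.toClass ↔ ∃ g, conjSubgroup g A.1 = B.1 :=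
  Quotient.eq (r := conjSetoid n)

theorem FactorClass.exists_rep {n : ℕ} (v : FactorClass n) : ∃ A : FreeFactor n, A.toClass = v :=
  Quotient.exists_rep v

/-- The partial order on conjugacy classes induced by inclusion: `[A] ≤ [B]` if some conjugate
of `A` is contained in `B`. -/
instance (n : ℕ) : PartialOrder (FactorClass n) where
  le v w := ∃ A B : FreeFactor n, A.toClass = v ∧ B.toClass = w ∧
    ∃ g : FreeGroup (Fin n), conjSubgroup g A.1 ≤ B.1
  le_refl v := by
    obtain ⟨A, rfl⟩ := v.exists_rep
    exact ⟨A, A, rfl, rfl, 1, (conjSubgroup_one _).le⟩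
  le_trans u v w := by
    rintro ⟨A, B, rfl, rfl, g, hAB⟩ ⟨B', C, hB, rfl, h, hBC⟩
    obtain ⟨k, hk⟩ := FreeFactor.toClass_eq_iff.1 hB.symm
    refine ⟨A, C, rfl, rfl, h * (k * g), ?_⟩
    rw [conjSubgroup_mul, conjSubgroup_mul]
    exact (conjSubgroup_mono h ((conjSubgroup_mono k hAB).trans hk.le)).trans hBC
  le_antisymm u v := by
    rintro ⟨A, B, rfl, rfl, g, hAB⟩ ⟨B', A', hB, hA, h, hBA⟩
    obtain ⟨k, hk⟩ := FreeFactor.toClass_eq_iff.1 hB.symm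
    obtain ⟨l, hl⟩ := FreeFactor.toClass_eq_iff.1 hA
    have h1 : conjSubgroup (l * h * k) B.1 ≤ A.1 := by
      rw [conjSubgroup_mul, conjSubgroup_mul, hk, ← hl]
      exact conjSubgroup_mono l hBA
    have h2 : conjSubgroup (g * (l * h * k)) B.1 = B.1 := by
      refine B.2.1.conj_eq_of_le ?_
      rw [conjSubgroup_mul]
      exact (conjSubgroup_mono g h1).trans hAB
    refine FreeFactor.toClass_eq_iff.2 ⟨g, le_antisymm hAB ?_⟩
    rw [conjSubgroup_mul] at h2
    exact h2.ge.trans (conjSubgroup_mono g h1)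

/-- The vertex `[A]` has rank `k`, i.e. it is the class of a free factor of rank `k`. -/
def FactorClass.HasRank {n : ℕ} (v : FactorClass n) (k : ℕ) : Prop :=
  ∃ A : FreeFactor n, A.toClass = v ∧ A.HasRank k

/-- The complex `𝒪ℱ_n` of conjugacy classes of free factors. -/
def complexOF (n : ℕ) : AbstractSimplicialComplex (FactorClass n) :=
  orderComplex (FactorClass n)

/-- The rank `n - 1` vertex `v = [Λ]` and the rank `1` vertex `w = [u]` of `𝒪ℱ_n` are algebraically
antipodal: there are representatives with `Λ₀ * ⟨u₀⟩ = F_n`. -/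
def AlgebraicallyAntipodal {n : ℕ} (v w : FactorClass n) : Prop :=
  v.HasRank (n - 1) ∧ w.HasRank 1 ∧
    ∃ A U : FreeFactor n, A.toClass = v ∧ U.toClass = w ∧ IsInternalFreeProduct A.1 U.1

/-! ### Apartments -/

/-- The standard apartment of `𝒜ℱ_n` associated to a basis of `F_n`: the full subcomplex spanned
by the free factors generated by the non-empty proper subsets of the basis. -/
def standardApartmentAF {n : ℕ} (b : FreeGroupBasis (Fin n) (FreeGroup (Fin n))) :
    PreAbstractSimplicialComplex (FreeFactor n) :=
  (complexAF n).fullSubcomplex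
    {A | ∃ S : ProperFace n, A.1 = Subgroup.closure (b '' (S.1 : Set (Fin n)))}

/-- An apartment of `𝒪ℱ_n`, presented by a parametrization: a simplicial embedding `σ` of the
subdivided boundary of the `(n - 1)`-simplex in `𝒪ℱ_n` such that `σ S` has rank `|S|` for all `S`.
The apartment itself is the subcomplex `σ.image`. -/
structure ParametrizedApartment (n : ℕ) extends
    SimplicialEmbedding (boundarySimplex n) (complexOF n) where
  hasRank : ∀ S : ProperFace n, (toFun S).HasRank S.1.card

open Classical in
/-- A subcomplex of `𝒪ℱ_n` is a standard apartment if it is the image of a standard apartment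
under the projection `𝒜ℱ_n → 𝒪ℱ_n`. -/
def IsStandardApartment {n : ℕ} (Δ : PreAbstractSimplicialComplex (FactorClass n)) : Prop :=
  ∃ b : FreeGroupBasis (Fin n) (FreeGroup (Fin n)),
    Δ = (standardApartmentAF b).map FreeFactor.toClass

/-- The vertex `{i}` of the simplex with vertices `0, 1, 2`. -/
def corner (i : Fin 3) : ProperFace 3 :=
  ⟨{i}, by revert i; decide⟩

/-- The barycentre `{0, 1, 2} ∖ {i}` of the face opposite the vertex `i` of the simplex with
vertices `0, 1, 2`. -/
def oppositeFace (i : Fin 3) : ProperFace 3 :=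
  ⟨{i}ᶜ, by revert i; decide⟩

end

/-! Let a_i generate a representative of the corner i and let V_i represent the opposite rank-2
vertex. The incidences hold only up to separate conjugations, and the task is to remove these one
after another.

If conjugates of basis elements of a free group lie in a subgroup, then up to conjugation in that
subgroup they are part of a basis of it: in the Schreier coset graph they are loops, and loops avoid
every spanning tree (`IsFreeBasisOf.exists_basis_of_conj_mem`). With antipodality of opposite
vertices this shows that each V_i has a basis consisting of conjugates of the two a_j with j ≠ i
(`IsStickConfiguration.exists_conj_basis`). After conjugation, a_0, a_1, a_2 is a basis of the whole
group, V_0 = ⟨a_1, a_2⟩, V_1 = ⟨a_0, l a_2 l⁻¹⟩ and V_2 = ⟨a_0, k a_1 k⁻¹⟩; what remains is to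
control k and l.

The sticks do this. A stick of V_2, being antipodal to V_0 and V_1, is up to inversion conjugate to
a_0 (k a_1^m k⁻¹) with m ≠ 0 (`exists_stick_form`, `stick_exponent_ne_zero`). An element completing
all basis elements but one to a basis contains the missing letter exactly once
(`letterCount_eq_one`): its Fox derivative is left invertible in the group ring, and since free
groups have unique products such an element has a one-point support. On the other hand, if g is the
shortest representative of ⟨a_0⟩ k ⟨a_1⟩, the cyclically reduced word a_0 g a_1^m g⁻¹ contains every
letter of g twice (`exists_conjugator_letterCount_le`). So g avoids the missing letter.

Antipodality to V_0 thus puts k, and with a stick of V_1 also l, into V_0, after conjugating V_2 and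
V_1. Conjugation by l⁻¹ then makes l trivial, and antipodality to V_1 forces k = a_2^r a_1^q. A last
conjugation by a_2^(-r) gives the standard form. -/

/-- The family `f` is a free basis of the subgroup `H`. -/
def IsFreeBasisOf {G : Type*} [Group G] {ι : Type*} (f : ι → G) (H : Subgroup G) : Prop :=
  Function.Injective (FreeGroup.lift f) ∧ Subgroup.closure (Set.range f) = H

/-! ### Free bases of subgroups -/

namespace IsFreeBasisOf

variable {G : Type*} [Group G] {ι : Type*} {f : ι → G} {H : Subgroup G}

theorem mem (h : IsFreeBasisOf f H) (i : ι) : f i ∈ H :=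
  h.2 ▸ Subgroup.subset_closure (Set.mem_range_self i)

theorem ne_one (h : IsFreeBasisOf f H) (i : ι) : f i ≠ 1 := by
  intro h1
  have h2 : FreeGroup.lift f (FreeGroup.of i) = FreeGroup.lift f 1 := by simp [h1]
  exact FreeGroup.of_ne_one i (h.1 h2)

theorem surjective (h : IsFreeBasisOf f ⊤) : Function.Surjective (FreeGroup.lift f) := by
  rw [← MonoidHom.range_eq_top, FreeGroup.range_lift_eq_closure, h.2]

theorem exists_hom (h : IsFreeBasisOf f ⊤) {P : Type*} [Group P] (q : ι → P) :
    ∃ Φ : G →* P, ∀ i, Φ (f i) = q i := by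
  let e := MulEquiv.ofBijective _ ⟨h.1, h.surjective⟩
  refine ⟨(FreeGroup.lift q).comp e.symm.toMonoidHom, fun i => ?_⟩
  have : e.symm (f i) = FreeGroup.of i := by
    rw [MulEquiv.symm_apply_eq]
    exact FreeGroup.lift_apply_of.symm
  simp [this]

/-- A family with a retraction onto the free group is free. -/
theorem injective_of_hom {P : Type*} [Group P] {g : ι → P} (θ : P →* FreeGroup ι)
    (h : ∀ i, θ (g i) = FreeGroup.of i) : Function.Injective (FreeGroup.lift g) := by
  have h1 : θ.comp (FreeGroup.lift g) = MonoidHom.id _ := by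
    ext i
    simp [h]
  intro x y hxy
  have := congrArg θ hxy
  rwa [← MonoidHom.comp_apply, ← MonoidHom.comp_apply, h1] at this

end IsFreeBasisOf

/-! ### The Reidemeister–Schreier basis -/

/-- Well-founded recursion along a parent function. -/
theorem exists_transversal_of_parent {X G : Type*} [Group G] (x₀ : X) (d : X → ℕ) (p : X → X)
    (m : X → G) (h : ∀ x, x ≠ x₀ → d (p x) < d x) :
    ∃ t : X → G, t x₀ = 1 ∧ ∀ x, x ≠ x₀ → t x = m x * t (p x) := by
  classical
  let F : ∀ x, (∀ y, d y < d x → G) → G := fun x ih =>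
    if hx : x = x₀ then 1 else m x * ih (p x) (h x hx)
  refine ⟨(measure d).wf.fix F, ?_, fun x hx => ?_⟩
  · rw [WellFounded.fix_eq]
    simp [F]
  · rw [WellFounded.fix_eq]
    simp [F, hx]

/-- Schreier transversals exist. -/
theorem exists_schreier_transversal {G X ι : Type*} [Group G] [MulAction G X]
    [MulAction.IsPretransitive G X] (f : ι → G) (hf : Subgroup.closure (Set.range f) = ⊤)
    (x₀ : X) : ∃ (t : X → G) (d : X → ℕ), t x₀ = 1 ∧ ∀ x, x ≠ x₀ → ∃ y i, d y < d x ∧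
      ((x = f i • y ∧ t x = f i * t y) ∨ (y = f i • x ∧ t y = f i * t x)) := by
  classical
  have hsurj : Function.Surjective (FreeGroup.lift f) := by
    rw [← MonoidHom.range_eq_top, FreeGroup.range_lift_eq_closure, hf]
  have hex : ∀ x : X, ∃ n : ℕ, ∃ l : List (ι × Bool), l.length = n ∧
      FreeGroup.lift f (FreeGroup.mk l) • x₀ = x := by
    intro x
    obtain ⟨g, hg⟩ := MulAction.exists_smul_eq G x₀ x
    obtain ⟨w, rfl⟩ := hsurj g
    exact ⟨_, w.toWord, rfl, by rw [FreeGroup.mk_toWord, hg]⟩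
  let d : X → ℕ := fun x => Nat.find (hex x)
  -- The parent of `x` is reached by deleting the leftmost letter of a shortest word that carries
  -- `x₀` to `x`.
  have hpar : ∀ x, x ≠ x₀ → ∃ (y : X) (m : G), d y < d x ∧ x = m • y ∧
      ∃ i, m = f i ∨ m = (f i)⁻¹ := by
    intro x hx
    obtain ⟨l, hl, hlx⟩ := Nat.find_spec (hex x)
    rcases l with _ | ⟨⟨i, b⟩, l⟩
    · refine absurd ?_ hx
      rw [← hlx, ← FreeGroup.one_eq_mk, map_one, one_smul]
    · refine ⟨FreeGroup.lift f (FreeGroup.mk l) • x₀, cond b (f i) (f i)⁻¹, ?_, ?_, i,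
        by cases b <;> simp⟩
      · have h1 : d (FreeGroup.lift f (FreeGroup.mk l) • x₀) ≤ l.length :=
          Nat.find_min' _ ⟨l, rfl, rfl⟩
        have h2 : d x = l.length + 1 := by rw [← List.length_cons (a := (i, b)), hl]
        omega
      · rw [← mul_smul, ← hlx, FreeGroup.lift_mk, FreeGroup.lift_mk]
        simp
  choose! p m hd hp hm using hpar
  obtain ⟨t, ht0, ht⟩ := exists_transversal_of_parent x₀ d p m hd
  refine ⟨t, d, ht0, fun x hx => ?_⟩
  have h1 := hp x hx
  have h2 := ht x hx
  obtain ⟨i, hi⟩ := hm x hx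
  refine ⟨p x, i, hd x hx, ?_⟩
  rcases hi with hi | hi
  · left
    rw [hi] at h1 h2
    exact ⟨h1, h2⟩
  · right
    rw [hi] at h1 h2
    exact ⟨by rw [← inv_smul_eq_iff, ← h1], by rw [h2, mul_inv_cancel_left]⟩

/-- The Reidemeister–Schreier basis of a subgroup of a free group. -/
theorem exists_schreier_basis {G ι : Type*} [Group G] {f : ι → G} (hf : IsFreeBasisOf f ⊤)
    (Λ : Subgroup G) : ∃ t : G ⧸ Λ → G, (∀ x, t x • ((1 : G) : G ⧸ Λ) = x) ∧
      IsFreeBasisOf (fun e : {e : ι × (G ⧸ Λ) // (t (f e.1 • e.2))⁻¹ * f e.1 * t e.2 ≠ 1} =>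
        (t (f e.1.1 • e.1.2))⁻¹ * f e.1.1 * t e.1.2) Λ := by
  classical
  obtain ⟨t, d, ht0, ht⟩ := exists_schreier_transversal f hf.2 ((1 : G) : G ⧸ Λ)
  have htx : ∀ n x, d x = n → t x • ((1 : G) : G ⧸ Λ) = x := by
    intro n
    induction n using Nat.strong_induction_on with
    | _ n ih =>
      intro x hx
      by_cases h0 : x = ((1 : G) : G ⧸ Λ)
      · subst h0
        rw [ht0, one_smul]
      · obtain ⟨y, i, hy, ⟨h1, h2⟩ | ⟨h1, h2⟩⟩ := ht x h0
        · rw [h2, mul_smul, ih _ (hx ▸ hy) y rfl, ← h1]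
        · have h3 := ih _ (hx ▸ hy) y rfl
          rw [h2, mul_smul, h1] at h3
          exact smul_left_cancel _ h3
  replace htx := fun x => htx _ x rfl
  let γ : ι × (G ⧸ Λ) → G := fun e => (t (f e.1 • e.2))⁻¹ * f e.1 * t e.2
  let E := {e : ι × (G ⧸ Λ) // γ e ≠ 1}
  refine ⟨t, htx, ?_, ?_⟩
  -- Label each edge of the coset graph by its Schreier generator, trivially on the tree, and let
  -- `G` act on cosets paired with labels. Transversal elements do not change labels, so a word in
  -- the Schreier generators acts over the base coset as left multiplication by itself and can be
  -- read off from the action.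
  · let c : ι × (G ⧸ Λ) → FreeGroup E := fun e => if h : γ e ≠ 1 then FreeGroup.of ⟨e, h⟩ else 1
    let act : ι → Equiv.Perm ((G ⧸ Λ) × FreeGroup E) := fun i =>
      { toFun := fun p => (f i • p.1, c (i, p.1) * p.2)
        invFun := fun p => ((f i)⁻¹ • p.1, (c (i, (f i)⁻¹ • p.1))⁻¹ * p.2)
        left_inv := fun p => by simp
        right_inv := fun p => by simp }
    obtain ⟨Φ, hΦ⟩ := hf.exists_hom act
    have hact : ∀ i x h, act i (x, h) = (f i • x, c (i, x) * h) := fun _ _ _ => rfl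
    have htree : ∀ n x, d x = n → ∀ h, Φ (t x) (((1 : G) : G ⧸ Λ), h) = (x, h) := by
      intro n
      induction n using Nat.strong_induction_on with
      | _ n ih =>
        intro x hx h
        by_cases h0 : x = ((1 : G) : G ⧸ Λ)
        · subst h0
          simp [ht0]
        · obtain ⟨y, i, hy, ⟨h1, h2⟩ | ⟨h1, h2⟩⟩ := ht x h0
          · have hc : c (i, y) = 1 := by
              have : γ (i, y) = 1 := by simp only [γ]; rw [← h1, h2]; group
              simp [c, this]
            rw [h2, map_mul, Equiv.Perm.mul_apply, ih _ (hx ▸ hy) y rfl, hΦ, hact, hc, ← h1,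
              one_mul]
          · have hc : c (i, x) = 1 := by
              have : γ (i, x) = 1 := by simp only [γ]; rw [← h1, h2]; group
              simp [c, this]
            have h3 := ih _ (hx ▸ hy) y rfl h
            rw [h2, map_mul, Equiv.Perm.mul_apply, hΦ] at h3
            apply (act i).injective
            rw [h3, hact, hc, one_mul, ← h1]
    replace htree := fun x => htree _ x rfl
    have hγ : ∀ e : E, ∀ h, Φ (γ e.1) (((1 : G) : G ⧸ Λ), h) =
        (((1 : G) : G ⧸ Λ), FreeGroup.of e * h) := by
      intro e h
      have hc : c e.1 = FreeGroup.of e := by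
        simp only [c]
        rw [dif_pos e.2]
      simp only [γ]
      rw [map_mul, map_mul, Equiv.Perm.mul_apply, Equiv.Perm.mul_apply, htree, hΦ, hact, map_inv,
        Equiv.Perm.inv_eq_iff_eq, htree, ← hc]
    have hlift : ∀ w : FreeGroup E, ∀ h,
        Φ (FreeGroup.lift (fun e : E => γ e.1) w) (((1 : G) : G ⧸ Λ), h) =
          (((1 : G) : G ⧸ Λ), w * h) := by
      intro w
      induction w using FreeGroup.induction_on with
      | C1 => intro h; simp
      | of e => intro h; rw [FreeGroup.lift_apply_of, hγ]
      | inv_of e ih =>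
        intro h
        rw [map_inv, map_inv, Equiv.Perm.inv_eq_iff_eq, ih]
        simp
      | mul a b iha ihb =>
        intro h
        rw [map_mul, map_mul, Equiv.Perm.mul_apply, ihb, iha, mul_assoc]
    intro w w' hww
    have h1 := hlift w 1
    have h2 := hlift w' 1
    rw [show FreeGroup.lift (fun e : E => γ e.1) w = FreeGroup.lift (fun e : E => γ e.1) w' from hww,
      h2] at h1
    simpa using (Prod.ext_iff.1 h1).2.symm
  · apply le_antisymm
    · rw [Subgroup.closure_le]
      rintro _ ⟨⟨⟨i, x⟩, he⟩, rfl⟩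
      have h1 : ((t (f i • x))⁻¹ * f i * t x) • ((1 : G) : G ⧸ Λ) = ((1 : G) : G ⧸ Λ) := by
        rw [mul_smul, mul_smul, htx, inv_smul_eq_iff, htx]
      have h2 : (((t (f i • x))⁻¹ * f i * t x : G) : G ⧸ Λ) = ((1 : G) : G ⧸ Λ) := by
        rw [← h1]
        simp
      rw [eq_comm, QuotientGroup.eq] at h2
      simpa using h2
    · set C := Subgroup.closure (Set.range (fun e : E => γ e.1)) with hC
      have hmem : ∀ e, γ e ∈ C := by
        intro e
        by_cases h : γ e = 1
        · rw [h]; exact C.one_mem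
        · exact Subgroup.subset_closure ⟨⟨e, h⟩, rfl⟩
      -- The expression is a cocycle in `g`, so it suffices to treat generators; for `g` in `Λ` and
      -- the base coset it is `g` itself.
      have key : ∀ g : G, ∀ x, (t (g • x))⁻¹ * g * t x ∈ C := by
        intro g
        have hg : g ∈ Subgroup.closure (Set.range f) := by rw [hf.2]; trivial
        induction hg using Subgroup.closure_induction with
        | mem g hg =>
          obtain ⟨i, rfl⟩ := hg
          exact fun x => hmem (i, x)
        | one => intro x; simp [C.one_mem]
        | mul a b _ _ iha ihb =>
          intro x
          have := C.mul_mem (iha (b • x)) (ihb x)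
          rw [← mul_smul] at this
          convert this using 1
          group
        | inv a _ iha =>
          intro x
          have := C.inv_mem (iha (a⁻¹ • x))
          rw [smul_inv_smul] at this
          convert this using 1
          group
      intro g hg
      have h1 := key g ((1 : G) : G ⧸ Λ)
      have h2 : g • ((1 : G) : G ⧸ Λ) = ((1 : G) : G ⧸ Λ) := by
        change ((g * 1 : G) : G ⧸ Λ) = _
        rw [eq_comm, QuotientGroup.eq]
        simpa using hg
      rw [h2, ht0] at h1
      simpa using h1

/-! ### Transport of free bases -/

namespace IsFreeBasisOf

variable {G : Type*} [Group G] {ι : Type*} {f : ι → G} {H : Subgroup G}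

theorem exists_mulEquiv (h : IsFreeBasisOf f H) :
    ∃ φ : FreeGroup ι ≃* H, ∀ w, (φ w : G) = FreeGroup.lift f w := by
  obtain ⟨h1, rfl⟩ := h
  exact ⟨(MonoidHom.ofInjective h1).trans
    (MulEquiv.subgroupCongr FreeGroup.range_lift_eq_closure), fun w => rfl⟩

theorem of_freeGroupBasis (b : FreeGroupBasis ι H) : IsFreeBasisOf (fun i => (b i : G)) H := by
  have h1 : FreeGroup.lift (fun i => (b i : G)) = H.subtype.comp b.repr.symm.toMonoidHom := by
    ext i
    rw [FreeGroup.lift_apply_of]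
    rfl
  constructor
  · rw [h1]
    exact H.subtype_injective.comp b.repr.symm.injective
  · rw [← FreeGroup.range_lift_eq_closure, h1, MonoidHom.range_comp,
      MonoidHom.range_eq_top.2 b.repr.symm.surjective, ← MonoidHom.range_eq_map,
      Subgroup.range_subtype]

theorem map {G' : Type*} [Group G'] (h : IsFreeBasisOf f H) (φ : G →* G')
    (hφ : Function.Injective φ) : IsFreeBasisOf (fun i => φ (f i)) (H.map φ) := by
  have h1 : FreeGroup.lift (fun i => φ (f i)) = φ.comp (FreeGroup.lift f) := by
    ext i
    simp
  constructor
  · rw [h1]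
    exact hφ.comp h.1
  · rw [← h.2, MonoidHom.map_closure, ← Set.range_comp]
    rfl

theorem conj (h : IsFreeBasisOf f H) (c : G) :
    IsFreeBasisOf (fun i => c * f i * c⁻¹) (conjSubgroup c H) := by
  exact h.map (MulAut.conj c).toMonoidHom (MulAut.conj c).injective

theorem comp_equiv {κ : Type*} (h : IsFreeBasisOf f H) (e : κ ≃ ι) :
    IsFreeBasisOf (f ∘ e) H := by
  have h1 : FreeGroup.lift (f ∘ e) = (FreeGroup.lift f).comp
      (FreeGroup.freeGroupCongr e).toMonoidHom := by
    ext i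
    simp
  constructor
  · rw [h1]
    exact h.1.comp (FreeGroup.freeGroupCongr e).injective
  · rw [e.surjective.range_comp, h.2]

theorem nonempty_equiv {κ : Type*} {f' : κ → G} (h : IsFreeBasisOf f H)
    (h' : IsFreeBasisOf f' H) : Nonempty (ι ≃ κ) := by
  obtain ⟨φ, -⟩ := h.exists_mulEquiv
  obtain ⟨ψ, -⟩ := h'.exists_mulEquiv
  exact ⟨Equiv.ofFreeGroupEquiv (φ.trans ψ.symm)⟩

end IsFreeBasisOf

theorem conjSubgroup_of_mem {G : Type*} [Group G] {H : Subgroup G} {c : G} (hc : c ∈ H) :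
    conjSubgroup c H = H := by
  ext x
  rw [mem_conjSubgroup]
  constructor
  · intro h
    have := H.mul_mem (H.mul_mem hc h) (H.inv_mem hc)
    simpa [mul_assoc] using this
  · exact fun h => H.mul_mem (H.mul_mem (H.inv_mem hc) h) hc

/-! ### Basis elements conjugate into a subgroup -/

/-- Conjugates of basis elements that lie in a subgroup are, up to conjugation in the subgroup,
part of a basis of it. -/
theorem IsFreeBasisOf.exists_basis_of_conj_mem {G ι I : Type} [Group G] {f : ι → G}
    (hf : IsFreeBasisOf f ⊤) (Λ : Subgroup G) (j : I → ι) (hj : Function.Injective j) (g : I → G)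
    (hg : ∀ k, g k * f (j k) * (g k)⁻¹ ∈ Λ) :
    ∃ (E : Type) (e : E → G) (κ : I → E), Function.Injective κ ∧ IsFreeBasisOf e Λ ∧
      ∀ k, ∃ c ∈ Λ, e (κ k) = c * (g k * f (j k) * (g k)⁻¹) * c⁻¹ := by
  obtain ⟨t, ht, hb⟩ := exists_schreier_basis hf Λ
  have hmem : ∀ a : G, a • ((1 : G) : G ⧸ Λ) = ((1 : G) : G ⧸ Λ) ↔ a ∈ Λ := by
    intro a
    change ((a * 1 : G) : G ⧸ Λ) = _ ↔ _
    rw [eq_comm, QuotientGroup.eq]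
    simp
  -- The edge labelled `f (j k)` at the coset of `(g k)⁻¹` is a loop. Its Schreier generator is a
  -- conjugate of `f (j k)`, hence nontrivial.
  have hx : ∀ k, f (j k) • (g k)⁻¹ • ((1 : G) : G ⧸ Λ) = (g k)⁻¹ • ((1 : G) : G ⧸ Λ) := by
    intro k
    rw [eq_inv_smul_iff, ← mul_smul, ← mul_smul]
    simpa [mul_assoc] using (hmem _).2 (hg k)
  have hne : ∀ k, (t (f (j k) • (g k)⁻¹ • ((1 : G) : G ⧸ Λ)))⁻¹ * f (j k) *
      t ((g k)⁻¹ • ((1 : G) : G ⧸ Λ)) ≠ 1 := by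
    intro k h
    rw [hx] at h
    apply hf.ne_one (j k)
    rwa [← conj_eq_one_iff (a := (t ((g k)⁻¹ • ((1 : G) : G ⧸ Λ)))⁻¹), inv_inv]
  refine ⟨_, _, fun k => ⟨(j k, (g k)⁻¹ • ((1 : G) : G ⧸ Λ)), hne k⟩, ?_, hb, fun k => ?_⟩
  · intro k k' h
    exact hj (congrArg (fun e => e.1.1) h)
  · refine ⟨(g k * t ((g k)⁻¹ • ((1 : G) : G ⧸ Λ)))⁻¹, Λ.inv_mem ?_, ?_⟩
    · rw [← hmem, mul_smul, ht, smul_inv_smul]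
    · simp only [hx]
      group

/-- The Schreier basis has two elements because `Λ` has rank two. One of them is a `Λ`-conjugate of
the given element, and conjugating back inside `Λ` preserves the property of being a basis. -/
theorem IsFreeBasisOf.exists_pair_of_conj_mem {G ι : Type} [Group G] {f : ι → G}
    (hf : IsFreeBasisOf f ⊤) {Λ : Subgroup G} {x y : G} (hΛ : IsFreeBasisOf ![x, y] Λ) {i : ι}
    {g : G} (hg : g * f i * g⁻¹ ∈ Λ) : ∃ z, IsFreeBasisOf ![g * f i * g⁻¹, z] Λ := by
  obtain ⟨E, e, κ, -, he, hc⟩ := hf.exists_basis_of_conj_mem Λ (fun _ : Unit => i)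
    (fun _ _ _ => rfl) (fun _ => g) (fun _ => hg)
  obtain ⟨c, hcΛ, hce⟩ := hc ()
  obtain ⟨φ⟩ := hΛ.nonempty_equiv he
  classical
  have h1 := (he.comp_equiv (φ.trans (Equiv.swap (φ 0) (κ ())))).conj c⁻¹
  rw [conjSubgroup_of_mem (Λ.inv_mem hcΛ)] at h1
  refine ⟨c⁻¹ * e (Equiv.swap (φ 0) (κ ()) (φ 1)) * c⁻¹⁻¹, ?_⟩
  convert h1 using 1
  ext k
  fin_cases k
  · simp [hce, mul_assoc]
  · simp

/-- Distinct letters give distinct members of the Schreier basis, and two members exhaust it. Only a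
simultaneous conjugation in `Λ` is available for normalising, so the second element keeps a
conjugator `c`. -/
theorem IsFreeBasisOf.exists_conj_of_conj_mem {G ι : Type} [Group G] {f : ι → G}
    (hf : IsFreeBasisOf f ⊤) {Λ : Subgroup G} {x y : G} (hΛ : IsFreeBasisOf ![x, y] Λ) {i j : ι}
    (hij : i ≠ j) {g h : G} (hg : g * f i * g⁻¹ ∈ Λ) (hh : h * f j * h⁻¹ ∈ Λ) :
    ∃ c ∈ Λ, IsFreeBasisOf ![g * f i * g⁻¹, c * (h * f j * h⁻¹) * c⁻¹] Λ := by
  obtain ⟨E, e, κ, hκ, he, hc⟩ := hf.exists_basis_of_conj_mem Λ ![i, j]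
    (by intro a b hab; fin_cases a <;> fin_cases b <;> simp_all [eq_comm]) ![g, h]
    (by intro a; fin_cases a <;> simpa)
  obtain ⟨c, hcΛ, hce⟩ := hc 0
  obtain ⟨d, hdΛ, hde⟩ := hc 1
  obtain ⟨φ⟩ := hΛ.nonempty_equiv he
  have hbij : Function.Bijective κ := by
    have h1 : Function.Injective (φ.symm ∘ κ) := φ.symm.injective.comp hκ
    have h2 := Finite.injective_iff_bijective.1 h1
    have : κ = φ ∘ (φ.symm ∘ κ) := by ext; simp
    rw [this]
    exact φ.bijective.comp h2
  have h1 := (he.comp_equiv (Equiv.ofBijective κ hbij)).conj c⁻¹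
  rw [conjSubgroup_of_mem (Λ.inv_mem hcΛ)] at h1
  refine ⟨c⁻¹ * d, Λ.mul_mem (Λ.inv_mem hcΛ) hdΛ, ?_⟩
  convert h1 using 1
  ext k
  fin_cases k
  · simp [hce, mul_assoc]
  · simp [hde, mul_assoc]

/-! ### Unique products and one-sided units of group rings -/

theorem IsFreeGroup.exists_hom_ne_one {K : Type} [Group K] [IsFreeGroup K] [Nontrivial K] :
    ∃ φ : K →* Multiplicative ℤ, φ ≠ 1 := by
  obtain ⟨X, ⟨b⟩⟩ := IsFreeGroup.nonempty_basis (G := K)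
  have hX : Nonempty X := by
    by_contra h
    rw [not_nonempty_iff] at h
    exact not_subsingleton K b.repr.toEquiv.subsingleton
  obtain ⟨x⟩ := hX
  refine ⟨b.lift fun _ => Multiplicative.ofAdd 1, fun h => ?_⟩
  have := DFunLike.congr_fun h (b x)
  simp at this

/-- Free groups are unique product groups, because they are locally indicable. -/
theorem IsFreeGroup.exists_uniqueMul (n : ℕ) : ∀ (K : Type) [Group K] [IsFreeGroup K]
    (A B : Finset K), A.Nonempty → B.Nonempty → A.card + B.card ≤ n →
    ∃ a ∈ A, ∃ b ∈ B, UniqueMul A B a b := by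
  classical
  induction n with
  | zero =>
    intro K _ _ A B hA hB h
    have := hA.card_pos
    omega
  | succ n ih =>
    intro K _ _ A B hA hB h
    by_cases hAB : A.card ≤ 1 ∧ B.card ≤ 1
    · exact UniqueMul.of_card_le_one hA hB hAB.1 hAB.2
    obtain ⟨a₀, ha₀⟩ := id hA
    obtain ⟨b₀, hb₀⟩ := id hB
    -- Translate both sets so that they contain 1, and pass to the subgroup `L` that they generate,
    -- which is free again. A nontrivial homomorphism from `L` to ℤ is nonconstant on one of the
    -- translates, so the two fibres over a unique product in ℤ have smaller total size and the
    -- induction hypothesis applies to them.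
    let S : Set K := (fun a => a₀⁻¹ * a) '' A ∪ (fun b => b * b₀⁻¹) '' B
    let L := Subgroup.closure S
    have hAL : ∀ a ∈ A, a₀⁻¹ * a ∈ L := fun a ha =>
      Subgroup.subset_closure (Or.inl ⟨a, ha, rfl⟩)
    have hBL : ∀ b ∈ B, b * b₀⁻¹ ∈ L := fun b hb =>
      Subgroup.subset_closure (Or.inr ⟨b, hb, rfl⟩)
    let A' : Finset L := A.attach.image fun a => ⟨a₀⁻¹ * a.1, hAL a.1 a.2⟩
    let B' : Finset L := B.attach.image fun b => ⟨b.1 * b₀⁻¹, hBL b.1 b.2⟩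
    have hA' : ∀ x : L, x ∈ A' ↔ ∃ a ∈ A, a₀⁻¹ * a = x := by
      intro x
      simp [A', Subtype.ext_iff]
    have hB' : ∀ x : L, x ∈ B' ↔ ∃ b ∈ B, b * b₀⁻¹ = x := by
      intro x
      simp [B', Subtype.ext_iff]
    have hA1 : (1 : L) ∈ A' := (hA' _).2 ⟨a₀, ha₀, by simp⟩
    have hB1 : (1 : L) ∈ B' := (hB' _).2 ⟨b₀, hb₀, by simp⟩
    have hAc : A'.card ≤ A.card := Finset.card_image_le.trans Finset.card_attach.le
    have hBc : B'.card ≤ B.card := Finset.card_image_le.trans Finset.card_attach.le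
    have hnt : Nontrivial L := by
      rw [Subgroup.nontrivial_iff_ne_bot]
      intro hbot
      apply hAB
      have h1 : ∀ x ∈ L, x = 1 := by rw [hbot]; simp
      constructor
      · rw [Finset.card_le_one]
        intro a ha a' ha'
        exact mul_left_cancel ((h1 _ (hAL a ha)).trans (h1 _ (hAL a' ha')).symm)
      · rw [Finset.card_le_one]
        intro a ha a' ha'
        exact mul_right_cancel ((h1 _ (hBL a ha)).trans (h1 _ (hBL a' ha')).symm)
    obtain ⟨φ, hφ⟩ := IsFreeGroup.exists_hom_ne_one (K := L)
    obtain ⟨x, hx, hxφ⟩ : ∃ x : L, (x ∈ A' ∨ x ∈ B') ∧ φ x ≠ 1 := by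
      by_contra! hcon
      apply hφ
      have hle : L ≤ φ.ker.map L.subtype := by
        rw [Subgroup.closure_le]
        rintro _ (⟨a, ha, rfl⟩ | ⟨b, hb, rfl⟩)
        · exact ⟨⟨_, hAL a ha⟩, hcon _ (Or.inl ((hA' _).2 ⟨a, ha, rfl⟩)), rfl⟩
        · exact ⟨⟨_, hBL b hb⟩, hcon _ (Or.inr ((hB' _).2 ⟨b, hb, rfl⟩)), rfl⟩
      ext ⟨y, hy⟩
      obtain ⟨z, hz, hzy⟩ := hle hy
      have : z = ⟨y, hy⟩ := Subtype.ext hzy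
      rw [← this]
      exact congrArg _ hz
    obtain ⟨p, hp, q, hq, hpq⟩ := UniqueProds.uniqueMul_of_nonempty
      (A := A'.image φ.toMulHom) (B := B'.image φ.toMulHom)
      ⟨_, Finset.mem_image_of_mem _ hA1⟩ ⟨_, Finset.mem_image_of_mem _ hB1⟩
    obtain ⟨a, ha, rfl⟩ := Finset.mem_image.1 hp
    obtain ⟨b, hb, rfl⟩ := Finset.mem_image.1 hq
    have hlt : ({x ∈ A' | φ.toMulHom x = φ.toMulHom a} : Finset L).card +
        ({x ∈ B' | φ.toMulHom x = φ.toMulHom b} : Finset L).card < A'.card + B'.card := by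
      rcases hx with hx | hx
      · refine Nat.add_lt_add_of_lt_of_le (Finset.card_lt_card ?_)
          (Finset.card_le_card (Finset.filter_subset _ _))
        rw [Finset.filter_ssubset]
        by_contra! hcon
        exact hxφ ((hcon x hx).trans ((hcon 1 hA1).symm.trans φ.map_one))
      · refine Nat.add_lt_add_of_le_of_lt (Finset.card_le_card (Finset.filter_subset _ _))
          (Finset.card_lt_card ?_)
        rw [Finset.filter_ssubset]
        by_contra! hcon
        exact hxφ ((hcon x hx).trans ((hcon 1 hB1).symm.trans φ.map_one))
    obtain ⟨a', ha', b', hb', hab⟩ := ih L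
      {x ∈ A' | φ.toMulHom x = φ.toMulHom a} {x ∈ B' | φ.toMulHom x = φ.toMulHom b}
      ⟨a, Finset.mem_filter.2 ⟨ha, rfl⟩⟩ ⟨b, Finset.mem_filter.2 ⟨hb, rfl⟩⟩ (by omega)
    rw [Finset.mem_filter] at ha' hb'
    have hu := UniqueMul.of_image_filter φ.toMulHom ha'.2 hb'.2 hpq hab
    obtain ⟨α, hα, hαa⟩ := (hA' _).1 ha'.1
    obtain ⟨β, hβ, hβb⟩ := (hB' _).1 hb'.1
    refine ⟨α, hα, β, hβ, fun c d hc hd hcd => ?_⟩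
    have h1 := hu (a := ⟨_, hAL c hc⟩) (b := ⟨_, hBL d hd⟩) ((hA' _).2 ⟨c, hc, rfl⟩)
      ((hB' _).2 ⟨d, hd, rfl⟩) (by
        apply Subtype.ext
        simp only [Subgroup.coe_mul, ← hαa, ← hβb]
        calc a₀⁻¹ * c * (d * b₀⁻¹) = a₀⁻¹ * (c * d) * b₀⁻¹ := by group
          _ = _ := by rw [hcd]; group)
    rw [Subtype.ext_iff, Subtype.ext_iff, ← hαa, ← hβb] at h1
    exact ⟨mul_left_cancel h1.1, mul_right_cancel h1.2⟩

/-- In a group, the existence of one unique product for all finite nonempty sets already forces two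
as soon as there is more than one pair. -/
theorem IsFreeGroup.twoUniqueProds (K : Type) [Group K] [IsFreeGroup K] : TwoUniqueProds K :=
  haveI : UniqueProds K := ⟨fun hA hB => IsFreeGroup.exists_uniqueMul _ K _ _ hA hB le_rfl⟩
  UniqueProds.toTwoUniqueProds_of_group

/-- Left invertible elements of group rings of unique product groups are supported at one point. -/
theorem MonoidAlgebra.card_support_of_mul_eq_one {K : Type*} [Group K] [TwoUniqueProds K]
    {α β : MonoidAlgebra ℤ K} (h : α * β = 1) : β.coeff.support.card = 1 := by
  classical
  have hα : α ≠ 0 := by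
    rintro rfl
    rw [zero_mul] at h
    exact zero_ne_one h
  have hβ : β ≠ 0 := by
    rintro rfl
    rw [mul_zero] at h
    exact zero_ne_one h
  have hα' : 0 < α.coeff.support.card := by
    rw [Finset.card_pos, Finsupp.support_nonempty_iff]
    exact fun h0 => hα (MonoidAlgebra.coeff_injective h0)
  have hβ' : 0 < β.coeff.support.card := by
    rw [Finset.card_pos, Finsupp.support_nonempty_iff]
    exact fun h0 => hβ (MonoidAlgebra.coeff_injective h0)
  by_contra hne
  obtain ⟨p, hp, q, hq, hpq, hup, huq⟩ := TwoUniqueProds.uniqueMul_of_one_lt_card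
    (A := α.coeff.support) (B := β.coeff.support) (by
      have : 2 ≤ β.coeff.support.card := by omega
      nlinarith)
  -- A unique product survives in `α * β` with nonzero coefficient, so it equals 1. Two different
  -- unique pairs would then have the same product, against uniqueness.
  have key : ∀ p ∈ α.coeff.support ×ˢ β.coeff.support,
      UniqueMul α.coeff.support β.coeff.support p.1 p.2 → p.1 * p.2 = 1 := by
    intro p hp hup
    rw [Finset.mem_product, Finsupp.mem_support_iff, Finsupp.mem_support_iff] at hp
    have h1 := MonoidAlgebra.coeff_mul_mul_of_uniqueMul hup
    rw [h] at h1
    by_contra h2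
    rw [MonoidAlgebra.one_def, MonoidAlgebra.coeff_single, Finsupp.single_eq_of_ne h2] at h1
    exact mul_ne_zero hp.1 hp.2 h1.symm
  rw [Finset.mem_product] at hp hq
  have h1 := hup hq.1 hq.2 ((key q (Finset.mem_product.2 hq) huq).trans
    (key p (Finset.mem_product.2 hp) hup).symm)
  exact hpq (Prod.ext h1.1.symm h1.2.symm)

/-! ### Fox calculus and the single occurrence of an exchanged letter -/

section FoxDerivative

variable {ι : Type} [DecidableEq ι]

/-- The action of a free group on its group ring by affine maps whose translation parts are the
Fox derivatives with respect to the generator `i`. -/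
noncomputable def foxAction (i : ι) : FreeGroup ι →* Equiv.Perm (MonoidAlgebra ℤ (FreeGroup ι)) :=
  FreeGroup.lift fun k =>
    { toFun := fun r => MonoidAlgebra.of ℤ _ (FreeGroup.of k) * r + if k = i then 1 else 0
      invFun := fun r => MonoidAlgebra.of ℤ _ (FreeGroup.of k)⁻¹ * (r - if k = i then 1 else 0)
      left_inv := fun r => by
        simp only
        rw [add_sub_cancel_right, ← mul_assoc, ← map_mul, inv_mul_cancel, map_one, one_mul]
      right_inv := fun r => by
        simp only
        rw [← mul_assoc, ← map_mul, mul_inv_cancel, map_one, one_mul, sub_add_cancel] }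

/-- The Fox derivative with respect to the generator `i`. -/
noncomputable def foxDeriv (i : ι) (g : FreeGroup ι) : MonoidAlgebra ℤ (FreeGroup ι) := foxAction i g 0

theorem foxAction_of (i k : ι) (r : MonoidAlgebra ℤ (FreeGroup ι)) :
    foxAction i (FreeGroup.of k) r =
      MonoidAlgebra.of ℤ _ (FreeGroup.of k) * r + if k = i then 1 else 0 := by
  rw [foxAction, FreeGroup.lift_apply_of]
  rfl

theorem foxAction_apply (i : ι) (g : FreeGroup ι) :
    ∀ r, foxAction i g r = MonoidAlgebra.of ℤ _ g * r + foxDeriv i g := by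
  induction g using FreeGroup.induction_on with
  | C1 => intro r; rw [foxDeriv, map_one, map_one, one_mul]; simp
  | of k => intro r; rw [foxDeriv, foxAction_of, foxAction_of, mul_zero, zero_add]
  | inv_of k ih =>
    have h1 : ∀ r, foxAction i (FreeGroup.of k)⁻¹ r =
        MonoidAlgebra.of ℤ _ (FreeGroup.of k)⁻¹ * (r - foxDeriv i (FreeGroup.of k)) := by
      intro r
      rw [map_inv, Equiv.Perm.inv_eq_iff_eq, ih, ← mul_assoc, ← map_mul, mul_inv_cancel, map_one,
        one_mul, sub_add_cancel]
    intro r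
    rw [foxDeriv, h1, h1, ← mul_add]
    congr 1
    abel
  | mul a b iha ihb =>
    intro r
    rw [foxDeriv, map_mul, Equiv.Perm.mul_apply, Equiv.Perm.mul_apply, ihb, iha, ihb, iha, map_mul]
    simp only [mul_add, mul_assoc, mul_zero, zero_add, add_assoc]

theorem foxDeriv_mul (i : ι) (g h : FreeGroup ι) :
    foxDeriv i (g * h) = MonoidAlgebra.of ℤ _ g * foxDeriv i h + foxDeriv i g := by
  rw [foxDeriv, map_mul, Equiv.Perm.mul_apply, foxAction_apply]
  rfl

theorem foxDeriv_one (i : ι) : foxDeriv i (1 : FreeGroup ι) = 0 := by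
  simp [foxDeriv]

theorem foxDeriv_of (i k : ι) : foxDeriv i (FreeGroup.of k) = if k = i then 1 else 0 := by
  rw [foxDeriv, foxAction_of, mul_zero, zero_add]

theorem foxDeriv_inv (i : ι) (g : FreeGroup ι) :
    foxDeriv i g⁻¹ = -(MonoidAlgebra.of ℤ _ g⁻¹ * foxDeriv i g) := by
  have h := foxDeriv_mul i g⁻¹ g
  rw [inv_mul_cancel, foxDeriv_one] at h
  exact (neg_eq_of_add_eq_zero_right h.symm).symm

/-- The chain rule for an endomorphism which fixes all generators but one. -/
theorem foxDeriv_comp (i : ι) (φ : FreeGroup ι →* FreeGroup ι)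
    (hφ : ∀ k, k ≠ i → φ (FreeGroup.of k) = FreeGroup.of k) (g : FreeGroup ι) :
    foxDeriv i (φ g) = MonoidAlgebra.mapDomainRingHom ℤ φ (foxDeriv i g) *
      foxDeriv i (φ (FreeGroup.of i)) := by
  have hof : ∀ x, MonoidAlgebra.mapDomainRingHom ℤ φ (MonoidAlgebra.of ℤ _ x) =
      MonoidAlgebra.of ℤ _ (φ x) := by
    intro x
    simp
  induction g using FreeGroup.induction_on with
  | C1 => simp [foxDeriv_one]
  | of k =>
    by_cases h : k = i
    · subst h
      rw [foxDeriv_of k k, if_pos rfl, map_one, one_mul]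
    · rw [hφ k h, foxDeriv_of, if_neg h, map_zero, zero_mul]
  | inv_of k ih =>
    rw [map_inv φ, foxDeriv_inv, foxDeriv_inv, ih, map_neg, map_mul, hof, map_inv φ, neg_mul,
      mul_assoc]
  | mul a b iha ihb =>
    rw [map_mul, foxDeriv_mul, foxDeriv_mul, iha, ihb, map_add, map_mul, hof, add_mul, mul_assoc]

/-- The number of occurrences of the generator `i`, with either sign, in a word. -/
def letterCount (i : ι) (L : List (ι × Bool)) : ℕ := L.countP fun x => x.1 = i

theorem foxDeriv_mk_cons (i k : ι) (b : Bool) (L : List (ι × Bool)) :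
    foxDeriv i (FreeGroup.mk ((k, b) :: L)) =
      MonoidAlgebra.of ℤ _ (FreeGroup.mk [(k, b)]) * foxDeriv i (FreeGroup.mk L) +
        foxDeriv i (FreeGroup.mk [(k, b)]) := by
  rw [← foxDeriv_mul, FreeGroup.mul_mk]
  rfl

theorem coeff_foxDeriv_letter (i k : ι) (b : Bool) :
    (foxDeriv i (FreeGroup.mk [(k, b)])).coeff = if k = i then
      Finsupp.single (FreeGroup.mk (if b then [] else [(k, b)])) (if b then 1 else -1) else 0 := by
  have h0 : (0 : MonoidAlgebra ℤ (FreeGroup ι)).coeff = 0 := rfl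
  cases b
  · have h1 : (FreeGroup.mk [(k, false)] : FreeGroup ι) = (FreeGroup.of k)⁻¹ := rfl
    rw [h1, foxDeriv_inv, foxDeriv_of]
    by_cases h : k = i
    · rw [if_pos h, if_pos h, mul_one, MonoidAlgebra.of_apply, ← MonoidAlgebra.single_neg,
        MonoidAlgebra.coeff_single]
      rfl
    · rw [if_neg h, if_neg h, mul_zero, neg_zero, h0]
  · have h1 : (FreeGroup.mk [(k, true)] : FreeGroup ι) = FreeGroup.of k := rfl
    rw [h1, foxDeriv_of]
    by_cases h : k = i
    · rw [if_pos h, if_pos h, MonoidAlgebra.one_def, MonoidAlgebra.coeff_single]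
      rfl
    · rw [if_neg h, if_neg h, h0]

/-- The support of the Fox derivative of a reduced word consists of one prefix for each occurrence
of the generator. -/
theorem foxDeriv_support (i : ι) (L : List (ι × Bool)) (hL : FreeGroup.IsReduced L) :
    (foxDeriv i (FreeGroup.mk L)).coeff.support.card = letterCount i L ∧
      ∀ g ∈ (foxDeriv i (FreeGroup.mk L)).coeff.support, g.toWord <+: L ∧
        (g = 1 → L.head? = some (i, true)) := by
  induction L with
  | nil =>
    rw [← FreeGroup.one_eq_mk, foxDeriv_one]
    simp [letterCount]
  | cons x L ih =>
    obtain ⟨k, b⟩ := x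
    have hL' : FreeGroup.IsReduced L := hL.infix ⟨[(k, b)], [], by simp⟩
    obtain ⟨ih1, ih2⟩ := ih hL'
    set x : FreeGroup ι := FreeGroup.mk [(k, b)] with hx
    have hmul : (MonoidAlgebra.of ℤ _ x * foxDeriv i (FreeGroup.mk L)).coeff.support =
        (foxDeriv i (FreeGroup.mk L)).coeff.support.map (mulLeftEmbedding x) :=
      MonoidAlgebra.support_coeff_single_mul _ _ (by simp) _
    have hpre : ∀ g ∈ (foxDeriv i (FreeGroup.mk L)).coeff.support,
        (x * g).toWord = (k, b) :: g.toWord ∧ (x * g).toWord <+: (k, b) :: L := by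
      intro g hg
      have h1 : (k, b) :: g.toWord <+: (k, b) :: L := by
        rw [List.cons_prefix_cons]
        exact ⟨rfl, (ih2 g hg).1⟩
      have h2 : (x * g).toWord = (k, b) :: g.toWord := by
        conv_lhs => rw [← FreeGroup.mk_toWord (x := g), hx, FreeGroup.mul_mk, FreeGroup.toWord_mk]
        exact (hL.infix h1.isInfix).reduce_eq
      exact ⟨h2, h2 ▸ h1⟩
    have hadd : (foxDeriv i (FreeGroup.mk ((k, b) :: L))).coeff =
        (MonoidAlgebra.of ℤ _ x * foxDeriv i (FreeGroup.mk L)).coeff +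
          (foxDeriv i x).coeff := by
      rw [foxDeriv_mk_cons, MonoidAlgebra.coeff_add]
    rw [hx, coeff_foxDeriv_letter, ← hx] at hadd
    by_cases hk : k = i
    · subst hk
      rw [if_pos rfl] at hadd
      set p : FreeGroup ι := FreeGroup.mk (if b then [] else [(k, b)]) with hp
      have hpw : p.toWord = if b then [] else [(k, b)] := by
        rw [hp, FreeGroup.toWord_mk]
        cases b <;> simp [FreeGroup.reduce]
      have hsupp : (Finsupp.single p (if b then (1 : ℤ) else -1)).support = {p} :=
        Finsupp.support_single _ (by cases b <;> simp)
      -- The new prefix `p` does not cancel against the shifted ones. For a positive letter `p = 1`,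
      -- while every `x * g` has a nonempty word. For a negative letter `x * g = p` forces `g = 1`,
      -- so `L` begins with the inverse letter and the word is not reduced; the clause on `g = 1` in
      -- the statement serves this case.
      have hdisj : Disjoint
          (MonoidAlgebra.of ℤ _ x * foxDeriv k (FreeGroup.mk L)).coeff.support
          (Finsupp.single p (if b then (1 : ℤ) else -1)).support := by
        rw [hsupp, Finset.disjoint_singleton_right, hmul, Finset.mem_map]
        rintro ⟨g, hg, hgp⟩
        have h1 := (hpre g hg).1
        rw [show x * g = p from hgp, hpw] at h1
        cases b
        · simp only [Bool.false_eq_true, if_false, List.cons.injEq, true_and] at h1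
          have h2 := (ih2 g hg).2 (FreeGroup.toWord_eq_nil_iff.1 h1.symm)
          obtain _ | ⟨y, L⟩ := L
          · simp at h2
          · simp only [List.head?_cons, Option.some.injEq] at h2
            subst h2
            have := List.isChain_cons_cons.1 hL
            simp at this
        · simp at h1
      rw [hadd, Finsupp.support_add_eq hdisj, Finset.card_union_of_disjoint hdisj, hsupp, hmul,
        Finset.card_map, ih1, Finset.card_singleton]
      refine ⟨by simp [letterCount], fun g hg => ?_⟩
      rw [Finset.mem_union, Finset.mem_map, Finset.mem_singleton] at hg
      rcases hg with ⟨g, hg', rfl⟩ | rfl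
      · refine ⟨(hpre g hg').2, fun h1 => ?_⟩
        have := (hpre g hg').1
        rw [show x * g = 1 from h1] at this
        simp at this
      · rw [hpw]
        refine ⟨by cases b <;> simp, fun h1 => ?_⟩
        rw [h1] at hpw
        cases b <;> simp at hpw ⊢
    · rw [if_neg hk, add_zero] at hadd
      rw [hadd, hmul, Finset.card_map, ih1]
      refine ⟨by simp [letterCount, hk], fun g hg => ?_⟩
      obtain ⟨g, hg', rfl⟩ := Finset.mem_map.1 hg
      refine ⟨(hpre g hg').2, fun h1 => ?_⟩
      have := (hpre g hg').1
      rw [show x * g = 1 from h1] at this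
      simp at this

/-- If `s` together with all standard generators but `i` generates the free group, then `i` occurs
exactly once in the reduced word of `s`. -/
theorem letterCount_eq_one (i : ι) (s : FreeGroup ι)
    (hs : Subgroup.closure (Set.range (Function.update FreeGroup.of i s)) = ⊤) :
    letterCount i s.toWord = 1 := by
  let φ : FreeGroup ι →* FreeGroup ι := FreeGroup.lift (Function.update FreeGroup.of i s)
  have hsurj : Function.Surjective φ := by
    rw [← MonoidHom.range_eq_top, FreeGroup.range_lift_eq_closure, hs]
  have hφ : ∀ k, k ≠ i → φ (FreeGroup.of k) = FreeGroup.of k := by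
    intro k hk
    simp [φ, hk]
  have hφi : φ (FreeGroup.of i) = s := by simp [φ]
  -- Differentiating `φ w = FreeGroup.of i` by the chain rule exhibits a left inverse of the Fox
  -- derivative of `s`. Its support is therefore a single point, and the size of the support is the
  -- letter count.
  obtain ⟨w, hw⟩ := hsurj (FreeGroup.of i)
  have h1 := foxDeriv_comp i φ hφ w
  rw [hw, hφi, foxDeriv_of, if_pos rfl] at h1
  have := IsFreeGroup.twoUniqueProds (FreeGroup ι)
  have h2 := MonoidAlgebra.card_support_of_mul_eq_one h1.symm
  rwa [← FreeGroup.mk_toWord (x := s),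
    (foxDeriv_support i s.toWord FreeGroup.isReduced_toWord).1] at h2

end FoxDerivative

/-! ### Letter counts, conjugation and double cosets -/

theorem FreeGroup.of_eq_zpow {ι : Type} (j : ι) (b : Bool) :
    ∃ e : ℤ, FreeGroup.mk [(j, b)] = (FreeGroup.of j) ^ e := by
  cases b
  · exact ⟨-1, by rw [zpow_neg_one]; rfl⟩
  · exact ⟨1, by rw [zpow_one]; rfl⟩

theorem FreeGroup.mk_cons {ι : Type} (x : ι × Bool) (L : List (ι × Bool)) :
    FreeGroup.mk (x :: L) = FreeGroup.mk [x] * FreeGroup.mk L :=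
  (FreeGroup.mul_mk (L₁ := [x]) (L₂ := L)).symm

section LetterCount

variable {ι : Type} [DecidableEq ι]

theorem letterCount_mul_le (k : ι) (g h : FreeGroup ι) :
    letterCount k (g * h).toWord ≤ letterCount k g.toWord + letterCount k h.toWord := by
  rw [letterCount, letterCount, letterCount, ← List.countP_append, FreeGroup.toWord_mul]
  exact FreeGroup.reduce.red.sublist.countP_le

theorem letterCount_invRev (k : ι) (L : List (ι × Bool)) :
    letterCount k (FreeGroup.invRev L) = letterCount k L := by
  simp [letterCount, FreeGroup.invRev, List.countP_map, Function.comp_def]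

theorem letterCount_inv (k : ι) (g : FreeGroup ι) :
    letterCount k g⁻¹.toWord = letterCount k g.toWord := by
  rw [FreeGroup.toWord_inv, letterCount_invRev]

theorem letterCount_pow_le (k : ι) (g : FreeGroup ι) (n : ℕ) :
    letterCount k (g ^ n).toWord ≤ n * letterCount k g.toWord := by
  induction n with
  | zero => simp [letterCount]
  | succ n ih =>
    rw [pow_succ, add_mul, one_mul]
    exact (letterCount_mul_le _ _ _).trans (Nat.add_le_add_right ih _)

/-- Powers of a cyclically reduced word do not cancel, so their counts grow exactly linearly,
whereas conjugation by `c` costs at most a bounded amount, twice the count of `c`. Large powers give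
the inequality. -/
theorem letterCount_le_of_conj (k : ι) {L : List (ι × Bool)}
    (hL : FreeGroup.IsCyclicallyReduced L) {s c : FreeGroup ι}
    (hs : s = c * FreeGroup.mk L * c⁻¹) : letterCount k L ≤ letterCount k s.toWord := by
  have key : ∀ n : ℕ, n * letterCount k L ≤ n * letterCount k s.toWord +
      2 * letterCount k c.toWord := by
    intro n
    have h1 : n * letterCount k L = letterCount k (FreeGroup.mk L ^ n).toWord := by
      rw [FreeGroup.toWord_pow, FreeGroup.toWord_mk, hL.isReduced.reduce_eq,
        (hL.flatten_replicate n).isReduced.reduce_eq]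
      simp [letterCount, List.countP_flatten]
    have h2 : FreeGroup.mk L ^ n = c⁻¹ * s ^ n * c := by
      rw [hs, conj_pow]
      group
    rw [h1, h2]
    have h3 := letterCount_mul_le k (c⁻¹ * s ^ n) c
    have h4 := letterCount_mul_le k c⁻¹ (s ^ n)
    rw [letterCount_inv] at h4
    have h5 := letterCount_pow_le k s n
    omega
  by_contra! hlt
  have h1 := key (2 * letterCount k c.toWord + 1)
  have h2 := Nat.mul_le_mul_left (2 * letterCount k c.toWord + 1) hlt
  rw [Nat.mul_succ] at h2
  omega

theorem FreeGroup.of_zpow_eq_mk (j : ι) (m : ℤ) (hm : m ≠ 0) : ∃ (n : ℕ) (b : Bool),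
    (FreeGroup.of j) ^ m = FreeGroup.mk (List.replicate (n + 1) (j, b)) := by
  have h : ∀ n : ℕ, (FreeGroup.of j) ^ n = FreeGroup.mk (List.replicate n (j, true)) := by
    intro n
    rw [← FreeGroup.toWord_of_pow, FreeGroup.mk_toWord]
  obtain ⟨n, rfl | rfl⟩ := Int.eq_nat_or_neg m
  · obtain ⟨n, rfl⟩ := Nat.exists_eq_succ_of_ne_zero (n := n) (by simpa using hm)
    exact ⟨n, true, by rw [zpow_natCast, h]⟩
  · obtain ⟨n, rfl⟩ := Nat.exists_eq_succ_of_ne_zero (n := n) (by simpa using hm)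
    refine ⟨n, false, ?_⟩
    rw [zpow_neg, zpow_natCast, h, FreeGroup.inv_mk]
    simp [FreeGroup.invRev]

/-- Shortest representatives of double cosets of cyclic groups generated by letters. -/
theorem FreeGroup.exists_doubleCoset_rep (i j : ι) (n : ℕ) : ∀ h : FreeGroup ι,
    h.toWord.length ≤ n → ∃ (a b : ℤ) (g : FreeGroup ι),
      h = FreeGroup.of i ^ a * g * FreeGroup.of j ^ b ∧
      (∀ x ∈ g.toWord.head?, x.1 ≠ i) ∧ (∀ x ∈ g.toWord.getLast?, x.1 ≠ j) := by
  induction n with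
  | zero =>
    intro h hn
    have : h.toWord = [] := List.length_eq_zero_iff.1 (by omega)
    exact ⟨0, 0, h, by simp, by simp [this], by simp [this]⟩
  | succ n ih =>
    intro h hn
    by_cases hi : ∀ x ∈ h.toWord.head?, x.1 ≠ i
    · by_cases hj : ∀ x ∈ h.toWord.getLast?, x.1 ≠ j
      · exact ⟨0, 0, h, by simp, hi, hj⟩
      · push Not at hj
        obtain ⟨⟨k, b⟩, hx, hk⟩ := hj
        change k = j at hk
        subst hk
        obtain ⟨L, hL⟩ : ∃ L, h.toWord = L ++ [(k, b)] := by
          obtain ⟨hne, he⟩ := List.mem_getLast?_eq_getLast hx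
          exact ⟨_, by rw [he, List.dropLast_append_getLast hne]⟩
        have hred : FreeGroup.IsReduced (L ++ [(k, b)]) := hL ▸ FreeGroup.isReduced_toWord
        have hLr : (FreeGroup.mk L).toWord = L := by
          rw [FreeGroup.toWord_mk]
          exact (hred.infix ⟨[], [(k, b)], by simp⟩).reduce_eq
        obtain ⟨a, c, g, hg, h1, h2⟩ := ih (FreeGroup.mk L) (by
          rw [hLr]
          rw [hL, List.length_append] at hn
          simpa using hn)
        obtain ⟨e, he⟩ := FreeGroup.of_eq_zpow k b
        refine ⟨a, c + e, g, ?_, h1, h2⟩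
        rw [← FreeGroup.mk_toWord (x := h), hL, ← FreeGroup.mul_mk, hg, he, zpow_add]
        simp only [mul_assoc]
    · push Not at hi
      obtain ⟨⟨k, b⟩, hx, hk⟩ := hi
      change k = i at hk
      subst hk
      obtain ⟨L, hL⟩ : ∃ L, h.toWord = (k, b) :: L := ⟨_, (List.cons_head?_tail hx).symm⟩
      have hred : FreeGroup.IsReduced ((k, b) :: L) := hL ▸ FreeGroup.isReduced_toWord
      have hLr : (FreeGroup.mk L).toWord = L := by
        rw [FreeGroup.toWord_mk]
        exact (hred.infix ⟨[(k, b)], [], by simp⟩).reduce_eq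
      obtain ⟨a, c, g, hg, h1, h2⟩ := ih (FreeGroup.mk L) (by
        rw [hLr]
        rw [hL] at hn
        simpa using hn)
      obtain ⟨e, he⟩ := FreeGroup.of_eq_zpow k b
      refine ⟨e + a, c, g, ?_, h1, h2⟩
      rw [← FreeGroup.mk_toWord (x := h), hL, FreeGroup.mk_cons, hg, he, zpow_add]
      simp only [mul_assoc]

/-- The end conditions on `g` exclude cancellation at every seam, including the cyclic one; `i ≠ j`
covers the case in which `g` is empty and the two letters meet. -/
theorem isCyclicallyReduced_of_conj_form {i j : ι} (hij : i ≠ j) (n : ℕ) (b : Bool)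
    (g : FreeGroup ι) (hi : ∀ x ∈ g.toWord.head?, x.1 ≠ i)
    (hj : ∀ x ∈ g.toWord.getLast?, x.1 ≠ j) :
    FreeGroup.IsCyclicallyReduced ([(i, true)] ++
      (g.toWord ++ (List.replicate (n + 1) (j, b) ++ g⁻¹.toWord))) := by
  have hi' : ∀ x ∈ g⁻¹.toWord.getLast?, x.1 ≠ i := by
    intro x hx
    rw [FreeGroup.toWord_inv] at hx
    simp only [FreeGroup.invRev, List.getLast?_reverse, List.head?_map, Option.mem_def,
      Option.map_eq_some_iff] at hx
    obtain ⟨y, hy, rfl⟩ := hx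
    exact hi y hy
  have hj' : ∀ x ∈ g⁻¹.toWord.head?, x.1 ≠ j := by
    intro x hx
    rw [FreeGroup.toWord_inv] at hx
    simp only [FreeGroup.invRev, List.head?_reverse, List.getLast?_map, Option.mem_def,
      Option.map_eq_some_iff] at hx
    obtain ⟨y, hy, rfl⟩ := hx
    exact hj y hy
  have hg : FreeGroup.IsReduced g.toWord := FreeGroup.isReduced_toWord
  have hg' : FreeGroup.IsReduced g⁻¹.toWord := FreeGroup.isReduced_toWord
  have hrep : FreeGroup.IsReduced (List.replicate (n + 1) (j, b)) :=
    List.isChain_replicate_of_rel _ fun _ => rfl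
  have h1 : FreeGroup.IsReduced (List.replicate (n + 1) (j, b) ++ g⁻¹.toWord) := by
    refine List.isChain_append.2 ⟨hrep, hg', fun x hx y hy hxy => ?_⟩
    have : x = (j, b) := by simpa [List.getLast?_replicate, eq_comm] using hx
    subst this
    exact absurd hxy.symm (hj' y hy)
  have h2 : FreeGroup.IsReduced
      (g.toWord ++ (List.replicate (n + 1) (j, b) ++ g⁻¹.toWord)) := by
    refine List.isChain_append.2 ⟨hg, h1, fun x hx y hy hxy => ?_⟩
    have : y = (j, b) := by simpa [List.replicate_succ, eq_comm] using hy
    subst this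
    exact absurd hxy (hj x hx)
  have h3 : ∀ y ∈ (g.toWord ++ (List.replicate (n + 1) (j, b) ++ g⁻¹.toWord)).head?, y.1 ≠ i := by
    intro y hy
    rw [List.head?_append, Option.mem_def, Option.or_eq_some_iff] at hy
    rcases hy with hy | ⟨-, hy⟩
    · exact hi y hy
    · have : y = (j, b) := by simpa [List.replicate_succ, eq_comm] using hy
      subst this
      exact hij.symm
  have h4 : ∀ y ∈ (g.toWord ++ (List.replicate (n + 1) (j, b) ++ g⁻¹.toWord)).getLast?,
      y.1 ≠ i := by
    intro y hy
    rw [← List.append_assoc, List.getLast?_append, Option.mem_def, Option.or_eq_some_iff] at hy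
    rcases hy with hy | ⟨-, hy⟩
    · exact hi' y hy
    · have : y = (j, b) := by simpa [List.getLast?_append, List.getLast?_replicate, eq_comm] using hy
      subst this
      exact hij.symm
  refine ⟨List.isChain_append.2 ⟨List.isChain_singleton _, h2, fun x hx y hy hxy => ?_⟩, ?_⟩
  · have : x = (i, true) := by simpa [eq_comm] using hx
    subst this
    exact absurd hxy.symm (h3 y hy)
  · intro x hx y hy hxy
    have : y = (i, true) := by simpa [eq_comm] using hy
    subst this
    rw [List.getLast?_append, Option.mem_def, Option.or_eq_some_iff] at hx
    rcases hx with hx | ⟨-, hx⟩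
    · exact absurd hxy (h4 x hx)
    · have : x = (i, true) := by simpa [eq_comm] using hx
      rw [this]

/-- If `s` is conjugate to the product of a letter and a conjugate of a nontrivial power of another
letter, then the conjugator is controlled by the number of letters of `s`. -/
theorem exists_conjugator_letterCount_le {i j : ι} (hij : i ≠ j) {m : ℤ} (hm : m ≠ 0)
    {s h : FreeGroup ι}
    (hs : IsConj (FreeGroup.of i * (h * FreeGroup.of j ^ m * h⁻¹)) s) :
    ∃ (a b : ℤ) (g : FreeGroup ι), h = FreeGroup.of i ^ a * g * FreeGroup.of j ^ b ∧
      ∀ k, (if k = i then 1 else 0) + (if k = j then 1 else 0) + 2 * letterCount k g.toWord ≤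
        letterCount k s.toWord := by
  obtain ⟨a, b, g, hg, h1, h2⟩ := FreeGroup.exists_doubleCoset_rep i j _ h le_rfl
  refine ⟨a, b, g, hg, fun k => ?_⟩
  obtain ⟨n, β, hn⟩ := FreeGroup.of_zpow_eq_mk j m hm
  obtain ⟨c, hc⟩ := isConj_iff.1 hs
  have hL := isCyclicallyReduced_of_conj_form hij n β g h1 h2
  -- The power of `j` in `h` commutes with `FreeGroup.of j ^ m`, and the power of `i` commutes with
  -- the first letter, so it can be absorbed into the conjugator.
  have h3 : s = (c * FreeGroup.of i ^ a) * FreeGroup.mk ([(i, true)] ++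
      (g.toWord ++ (List.replicate (n + 1) (j, β) ++ g⁻¹.toWord))) *
      (c * FreeGroup.of i ^ a)⁻¹ := by
    rw [← FreeGroup.mul_mk, ← FreeGroup.mul_mk, ← FreeGroup.mul_mk, FreeGroup.mk_toWord,
      FreeGroup.mk_toWord, ← hn, ← hc, hg, show FreeGroup.mk [(i, true)] = FreeGroup.of i from rfl]
    group
  have h4 := letterCount_le_of_conj k hL h3
  refine le_trans ?_ h4
  have h5 := letterCount_inv k g
  simp only [letterCount, List.countP_append, List.countP_cons, List.countP_nil,
    List.countP_replicate, decide_eq_true_eq] at h5 ⊢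
  have h6 : (k = i) ↔ (i = k) := eq_comm
  have h7 : (k = j) ↔ (j = k) := eq_comm
  simp only [h6, h7]
  split_ifs <;> omega

/-- Elements whose words avoid the letter `i` lie in the subgroup generated by the others. -/
theorem mem_closure_of_letterCount_eq_zero (i : ι) (L : List (ι × Bool))
    (hL : letterCount i L = 0) :
    FreeGroup.mk L ∈ Subgroup.closure (FreeGroup.of '' {i}ᶜ) := by
  induction L with
  | nil => exact Subgroup.one_mem _
  | cons x L ih =>
    obtain ⟨k, b⟩ := x
    rw [letterCount, List.countP_cons] at hL
    have hk : k ≠ i := by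
      rintro rfl
      simp at hL
    obtain ⟨e, he⟩ := FreeGroup.of_eq_zpow k b
    rw [FreeGroup.mk_cons, he]
    refine Subgroup.mul_mem _ (Subgroup.zpow_mem _ (Subgroup.subset_closure
      (Set.mem_image_of_mem _ hk)) _) (ih ?_)
    rw [letterCount]
    omega

theorem mem_closure_of_letterCount_toWord_eq_zero (i : ι) (g : FreeGroup ι)
    (hg : letterCount i g.toWord = 0) : g ∈ Subgroup.closure (FreeGroup.of '' {i}ᶜ) := by
  rw [← FreeGroup.mk_toWord (x := g)]
  exact mem_closure_of_letterCount_eq_zero i _ hg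

/-- A word with exactly one occurrence of `i` decomposes accordingly. -/
theorem exists_decomposition_of_letterCount_eq_one (i : ι) (g : FreeGroup ι)
    (hg : letterCount i g.toWord = 1) :
    ∃ x ∈ Subgroup.closure (FreeGroup.of '' {i}ᶜ), ∃ y ∈ Subgroup.closure (FreeGroup.of '' {i}ᶜ),
      g = x * FreeGroup.of i * y ∨ g = x * (FreeGroup.of i)⁻¹ * y := by
  have h1 : 0 < g.toWord.countP fun x => x.1 = i := by
    rw [letterCount] at hg
    omega
  obtain ⟨⟨k, b⟩, hmem, hb⟩ := List.countP_pos_iff.1 h1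
  simp only [decide_eq_true_eq] at hb
  subst hb
  obtain ⟨L₁, L₂, hL⟩ := List.append_of_mem hmem
  rw [hL, letterCount, List.countP_append, List.countP_cons] at hg
  simp only [decide_true, if_true] at hg
  refine ⟨_, mem_closure_of_letterCount_eq_zero _ L₁ (by rw [letterCount]; omega), _,
    mem_closure_of_letterCount_eq_zero _ L₂ (by rw [letterCount]; omega), ?_⟩
  have h2 : g = FreeGroup.mk L₁ * FreeGroup.mk [(k, b)] * FreeGroup.mk L₂ := by
    rw [← FreeGroup.mk_toWord (x := g), hL, FreeGroup.mul_mk, FreeGroup.mul_mk]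
    simp
  cases b
  · right
    rw [h2]
    rfl
  · left
    rw [h2]
    rfl

end LetterCount

/-! ### Changes of basis and exchange of one element -/

namespace IsFreeBasisOf

section General

variable {G : Type*} [Group G] {ι : Type*} {f : ι → G} {H : Subgroup G}

/-- The lift of `f` factors as `Φ` after the lift of `f'`, so injectivity passes to the latter; `Φ`
need not be shown to be invertible. -/
theorem of_hom {f' : ι → G} (h : IsFreeBasisOf f ⊤) (Φ : G →* G) (hΦ : ∀ i, Φ (f' i) = f i)
    (hf : ∀ i, f i ∈ Subgroup.closure (Set.range f')) : IsFreeBasisOf f' ⊤ := by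
  have h1 : FreeGroup.lift f = Φ.comp (FreeGroup.lift f') := by
    ext i
    simp [hΦ]
  constructor
  · have h2 := h.1
    rw [h1] at h2
    exact Function.Injective.of_comp h2
  · rw [eq_top_iff, ← h.2, Subgroup.closure_le]
    rintro _ ⟨i, rfl⟩
    exact hf i

theorem conj_top (h : IsFreeBasisOf f ⊤) (c : G) :
    IsFreeBasisOf (fun i => c * f i * c⁻¹) ⊤ := by
  have := h.conj c
  rwa [conjSubgroup_of_mem (Subgroup.mem_top c)] at this

theorem conj_pair {x y : G} (h : IsFreeBasisOf ![x, y] H) (c : G) :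
    IsFreeBasisOf ![c * x * c⁻¹, c * y * c⁻¹] (conjSubgroup c H) := by
  convert h.conj c using 1
  ext i
  fin_cases i <;> rfl

theorem swap {x y : G} (h : IsFreeBasisOf ![x, y] H) : IsFreeBasisOf ![y, x] H := by
  convert h.comp_equiv (Equiv.swap 0 1) using 1
  ext i
  fin_cases i <;> simp

theorem swap_left {x y z : G} (h : IsFreeBasisOf ![x, y, z] H) : IsFreeBasisOf ![y, x, z] H := by
  convert h.comp_equiv (Equiv.swap 0 1) using 1
  ext i
  fin_cases i
  · simp
  · simp
  · exact congrArg ![x, y, z] (Equiv.swap_apply_of_ne_of_ne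
      (show (2 : Fin 3) ≠ 0 by decide) (show (2 : Fin 3) ≠ 1 by decide)).symm

theorem swap_right {x y z : G} (h : IsFreeBasisOf ![x, y, z] H) : IsFreeBasisOf ![x, z, y] H := by
  convert h.comp_equiv (Equiv.swap 1 2) using 1
  ext i
  fin_cases i
  · exact congrArg ![x, y, z] (Equiv.swap_apply_of_ne_of_ne
      (show (0 : Fin 3) ≠ 1 by decide) (show (0 : Fin 3) ≠ 2 by decide)).symm
  · simp
  · simp

theorem mem_left {x y : G} (h : IsFreeBasisOf ![x, y] H) : x ∈ H := h.mem 0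

theorem mem_right {x y : G} (h : IsFreeBasisOf ![x, y] H) : y ∈ H := h.mem 1

theorem closure_pair {x y : G} (h : IsFreeBasisOf ![x, y] H) :
    Subgroup.closure {x, y} = H := by
  rw [← h.2]
  congr 1
  simp [Set.pair_comm]

theorem inv_last {x y z : G} (h : IsFreeBasisOf ![x, y, z] ⊤) :
    IsFreeBasisOf ![x, y, z⁻¹] ⊤ := by
  obtain ⟨Φ, hΦ⟩ := h.exists_hom ![x, y, z⁻¹]
  have h0 : Φ x = x := hΦ 0
  have h1 : Φ y = y := hΦ 1
  have h2 : Φ z = z⁻¹ := hΦ 2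
  refine h.of_hom Φ (fun i => ?_) (fun i => ?_)
  · fin_cases i
    · exact h0
    · exact h1
    · simp [h2]
  · have hm : ∀ i, ![x, y, z⁻¹] i ∈ Subgroup.closure (Set.range ![x, y, z⁻¹]) := fun i =>
      Subgroup.subset_closure (Set.mem_range_self i)
    fin_cases i
    · exact hm 0
    · exact hm 1
    · simpa using Subgroup.inv_mem _ (hm 2)

theorem conj_first {x y z c : G} (h : IsFreeBasisOf ![x, y, z] ⊤)
    (hc : c ∈ Subgroup.closure {y, z}) : IsFreeBasisOf ![c * x * c⁻¹, y, z] ⊤ := by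
  obtain ⟨Φ, hΦ⟩ := h.exists_hom ![c⁻¹ * x * c, y, z]
  have h0 : Φ x = c⁻¹ * x * c := hΦ 0
  have h1 : Φ y = y := hΦ 1
  have h2 : Φ z = z := hΦ 2
  have hΦc : Φ c = c := by
    have hle : Subgroup.closure {y, z} ≤ Φ.eqLocus (MonoidHom.id G) := by
      rw [Subgroup.closure_le]
      rintro _ (rfl | rfl)
      exacts [h1, h2]
    exact hle hc
  refine h.of_hom Φ (fun i => ?_) (fun i => ?_)
  · fin_cases i
    · simp [h0, hΦc, mul_assoc]
    · exact h1
    · exact h2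
  · set C := Subgroup.closure (Set.range ![c * x * c⁻¹, y, z])
    have hm : ∀ i, ![c * x * c⁻¹, y, z] i ∈ C := fun i =>
      Subgroup.subset_closure (Set.mem_range_self i)
    have hcC : c ∈ C := by
      refine (Subgroup.closure_le C).2 ?_ hc
      rintro _ (rfl | rfl)
      exacts [hm 1, hm 2]
    fin_cases i
    · have := C.mul_mem (C.mul_mem (C.inv_mem hcC) (hm 0)) hcC
      simpa [mul_assoc] using this
    · exact hm 1
    · exact hm 2

/-- A basis element is not conjugate into the subgroup generated by the others. -/
theorem conj_notMem {x y s k : G} {B : Subgroup G} (hB : IsFreeBasisOf ![x, y] B)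
    (h : IsFreeBasisOf ![x, y, s] ⊤) : k * s * k⁻¹ ∉ B := by
  intro hk
  obtain ⟨Φ, hΦ⟩ := h.exists_hom ![1, 1, Multiplicative.ofAdd (1 : ℤ)]
  have h0 : Φ x = 1 := hΦ 0
  have h1 : Φ y = 1 := hΦ 1
  have h2 : Φ s = Multiplicative.ofAdd (1 : ℤ) := hΦ 2
  have hle : B ≤ Φ.ker := by
    rw [← hB.closure_pair, Subgroup.closure_le]
    rintro _ (rfl | rfl)
    exacts [h0, h1]
  have h3 : Φ (k * s * k⁻¹) = 1 := hle hk
  rw [map_mul, map_mul, map_inv, h2, mul_comm, inv_mul_cancel_left] at h3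
  simp at h3

/-- The union of bases of the factors is a basis of a free product. -/
theorem sumElim {κ : Type*} {f' : κ → G} {A B : Subgroup G} (hAB : IsInternalFreeProduct A B)
    (h : IsFreeBasisOf f A) (h' : IsFreeBasisOf f' B) : IsFreeBasisOf (Sum.elim f f') ⊤ := by
  obtain ⟨φ, hφ⟩ := h.exists_mulEquiv
  obtain ⟨ψ, hψ⟩ := h'.exists_mulEquiv
  let e := MulEquiv.ofBijective _ hAB
  have hA : ∀ i, e.symm (f i) = Monoid.Coprod.inl (φ (FreeGroup.of i)) := by
    intro i
    rw [MulEquiv.symm_apply_eq]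
    refine Eq.trans ?_ (Monoid.Coprod.lift_apply_inl A.subtype B.subtype _).symm
    rw [Subgroup.subtype_apply, hφ, FreeGroup.lift_apply_of]
  have hB : ∀ i, e.symm (f' i) = Monoid.Coprod.inr (ψ (FreeGroup.of i)) := by
    intro i
    rw [MulEquiv.symm_apply_eq]
    refine Eq.trans ?_ (Monoid.Coprod.lift_apply_inr A.subtype B.subtype _).symm
    rw [Subgroup.subtype_apply, hψ, FreeGroup.lift_apply_of]
  constructor
  · refine injective_of_hom ((Monoid.Coprod.lift
      ((FreeGroup.map Sum.inl).comp φ.symm.toMonoidHom)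
      ((FreeGroup.map Sum.inr).comp ψ.symm.toMonoidHom)).comp e.symm.toMonoidHom) ?_
    rintro (i | i)
    · simp [hA]
    · simp [hB]
  · rw [Set.Sum.elim_range, Subgroup.closure_union, h.2, h'.2]
    have := MonoidHom.range_eq_top.2 hAB.surjective
    rwa [Monoid.Coprod.range_lift, Subgroup.range_subtype, Subgroup.range_subtype] at this

theorem triple_of_freeProduct {x y s : G} {A U : Subgroup G} (hAU : IsInternalFreeProduct A U)
    (h : IsFreeBasisOf ![x, y] A) (h' : IsFreeBasisOf (fun _ : Fin 1 => s) U) :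
    IsFreeBasisOf ![x, y, s] ⊤ := by
  convert (sumElim hAU h h').comp_equiv (finSumFinEquiv (m := 2) (n := 1)).symm using 1
  ext i
  fin_cases i <;> rfl

end General

/-- Exchanging one element of a basis, in coordinates. -/
theorem exists_coordinates_of_update {G ι : Type*} [Group G] [DecidableEq ι] {f : ι → G}
    {H : Subgroup G} (h : IsFreeBasisOf f H) {i : ι} {s : G}
    (h' : IsFreeBasisOf (Function.update f i s) H) :
    ∃ w, FreeGroup.lift f w = s ∧
      Subgroup.closure (Set.range (Function.update FreeGroup.of i w)) = ⊤ := by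
  have hs : s ∈ (FreeGroup.lift f).range := by
    rw [FreeGroup.range_lift_eq_closure, h.2]
    simpa using h'.mem i
  obtain ⟨w, hw⟩ := hs
  refine ⟨w, hw, ?_⟩
  apply Subgroup.map_injective h.1
  rw [MonoidHom.map_closure, ← Set.range_comp, ← MonoidHom.range_eq_map,
    FreeGroup.range_lift_eq_closure, h.2, ← h'.2]
  congr 2
  ext k
  by_cases hk : k = i
  · subst hk
    simp [hw]
  · simp [hk]

theorem lift_mem_closure {G ι : Type*} [Group G] (f : ι → G) (S : Set ι) {w : FreeGroup ι}
    (hw : w ∈ Subgroup.closure (FreeGroup.of '' S)) :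
    FreeGroup.lift f w ∈ Subgroup.closure (f '' S) := by
  have := Subgroup.mem_map_of_mem (FreeGroup.lift f) hw
  simpa only [MonoidHom.map_closure, Set.image_image, FreeGroup.lift_apply_of] using this

/-- Two bases of a free group of rank two which share an element. -/
theorem eq_of_common_element {G : Type*} [Group G] {W : Subgroup G} {x b u : G}
    (h : IsFreeBasisOf ![x, b] W) (h' : IsFreeBasisOf ![u, b] W) :
    ∃ p q : ℤ, u = b ^ p * x * b ^ q ∨ u = b ^ p * x⁻¹ * b ^ q := by
  have h2 : IsFreeBasisOf (Function.update ![x, b] 0 u) W := by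
    convert h' using 1
    ext k
    fin_cases k <;> simp
  -- In the coordinates of the first basis `u` contains `x` exactly once, with exponent 1 or -1.
  -- What stands on either side of it is a power of `b`.
  obtain ⟨w, hw, hcl⟩ := h.exists_coordinates_of_update h2
  obtain ⟨y, hy, z, hz, hyz⟩ := exists_decomposition_of_letterCount_eq_one 0 w
    (letterCount_eq_one 0 w hcl)
  have himg : (![x, b] '' {0}ᶜ : Set G) = {b} := by
    ext t
    simp [Fin.exists_fin_two, eq_comm]
  have hy' := lift_mem_closure ![x, b] _ hy
  have hz' := lift_mem_closure ![x, b] _ hz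
  rw [himg, ← Subgroup.zpowers_eq_closure, Subgroup.mem_zpowers_iff] at hy' hz'
  obtain ⟨p, hp⟩ := hy'
  obtain ⟨q, hq⟩ := hz'
  refine ⟨p, q, ?_⟩
  rw [hp, hq, ← hw]
  rcases hyz with rfl | rfl
  · left; simp
  · right; simp

theorem exists_conjugator_mem {G ι : Type} [Group G] [DecidableEq ι] {f : ι → G}
    (h : IsFreeBasisOf f ⊤) {i j k : ι} (hij : i ≠ j) {m : ℤ} (hm : m ≠ 0) {s c : G}
    (hs : IsConj (f i * (c * f j ^ m * c⁻¹)) s) (h' : IsFreeBasisOf (Function.update f k s) ⊤) :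
    ∃ (p q : ℤ) (g : G), c = f i ^ p * g * f j ^ q ∧ g ∈ Subgroup.closure (f '' {k}ᶜ) := by
  obtain ⟨w, rfl, hcl⟩ := h.exists_coordinates_of_update h'
  obtain ⟨c, rfl⟩ := h.surjective c
  obtain ⟨d, hd⟩ := isConj_iff.1 hs
  obtain ⟨d, rfl⟩ := h.surjective d
  have hs' : IsConj (FreeGroup.of i * (c * FreeGroup.of j ^ m * c⁻¹)) w := by
    refine isConj_iff.2 ⟨d, h.1 ?_⟩
    rw [← hd]
    simp
  obtain ⟨p, q, g, rfl, hg⟩ := exists_conjugator_letterCount_le hij hm hs'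
  refine ⟨p, q, FreeGroup.lift f g, by simp, lift_mem_closure f _ ?_⟩
  apply mem_closure_of_letterCount_toWord_eq_zero
  have h1 := hg k
  rw [letterCount_eq_one k w hcl] at h1
  omega

end IsFreeBasisOf

/-! ### Normalising configurations with sticks -/

section Configuration

variable {G : Type} [Group G]

/-- The element `s` extends every basis of `A` to a basis of the ambient group. -/
def IsComplementary (A : Subgroup G) (s : G) : Prop :=
  ∀ x y, IsFreeBasisOf ![x, y] A → IsFreeBasisOf ![x, y, s] ⊤

theorem IsComplementary.conj {A : Subgroup G} {s : G} (h : IsComplementary A s) (c : G) :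
    IsComplementary (conjSubgroup c A) (c * s * c⁻¹) := by
  intro x y hxy
  have h1 := hxy.conj_pair c⁻¹
  rw [← conjSubgroup_mul, inv_mul_cancel, conjSubgroup_one] at h1
  have h2 := (h _ _ h1).conj_top c
  convert h2 using 1
  ext i
  fin_cases i <;> simp [mul_assoc]

theorem IsComplementary.inv {A : Subgroup G} {s : G} (h : IsComplementary A s) :
    IsComplementary A s⁻¹ :=
  fun x y hxy => (h x y hxy).inv_last

/-- Rank two subgroups `V i`, elements `a i` and sticks `u i` with the incidence and antipodality
relations of an apartment, up to conjugation. -/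
structure IsStickConfiguration (V : Fin 3 → Subgroup G) (a u : Fin 3 → G) : Prop where
  rank : ∀ i, ∃ x y, IsFreeBasisOf ![x, y] (V i)
  conj_mem : ∀ i j, j ≠ i → ∃ g, g * a j * g⁻¹ ∈ V i
  opposite : ∀ i, ∃ g, IsComplementary (V i) (g * a i * g⁻¹)
  stick_mem : ∀ i, u i ∈ V i
  stick : ∀ i j, j ≠ i → ∃ g, IsComplementary (V j) (g * u i * g⁻¹)

theorem IsStickConfiguration.conj {V : Fin 3 → Subgroup G} {a u : Fin 3 → G}
    (h : IsStickConfiguration V a u) (c d : Fin 3 → G) :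
    IsStickConfiguration (fun i => conjSubgroup (d i) (V i)) (fun i => c i * a i * (c i)⁻¹)
      (fun i => d i * u i * (d i)⁻¹) where
  rank i := by
    obtain ⟨x, y, hxy⟩ := h.rank i
    exact ⟨_, _, hxy.conj_pair (d i)⟩
  conj_mem i j hij := by
    obtain ⟨g, hg⟩ := h.conj_mem i j hij
    refine ⟨d i * g * (c j)⁻¹, ?_⟩
    rw [mem_conjSubgroup]
    convert hg using 1
    group
  opposite i := by
    obtain ⟨g, hg⟩ := h.opposite i
    refine ⟨d i * g * (c i)⁻¹, ?_⟩
    convert hg.conj (d i) using 1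
    group
  stick_mem i := by
    rw [mem_conjSubgroup]
    convert h.stick_mem i using 1
    group
  stick i j hij := by
    obtain ⟨g, hg⟩ := h.stick i j hij
    refine ⟨d j * g * (d i)⁻¹, ?_⟩
    convert hg.conj (d j) using 1
    group

/-- Up to conjugation, the `a i` form a basis and the `V i` are generated by pairs of them. -/
def IsStandardUpToConj (V : Fin 3 → Subgroup G) (a : Fin 3 → G) : Prop :=
  ∃ c d : Fin 3 → G, IsFreeBasisOf (fun i => c i * a i * (c i)⁻¹) ⊤ ∧
    ∀ i, conjSubgroup (d i) (V i) = Subgroup.closure ((fun j => c j * a j * (c j)⁻¹) '' {i}ᶜ)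

theorem IsStandardUpToConj.of_conj {V : Fin 3 → Subgroup G} {a : Fin 3 → G} {c d : Fin 3 → G}
    (h : IsStandardUpToConj (fun i => conjSubgroup (d i) (V i))
      (fun i => c i * a i * (c i)⁻¹)) : IsStandardUpToConj V a := by
  obtain ⟨c', d', h1, h2⟩ := h
  have h3 : (fun i => c' i * (c i * a i * (c i)⁻¹) * (c' i)⁻¹) =
      fun i => (c' i * c i) * a i * (c' i * c i)⁻¹ := by
    ext i
    group
  rw [h3] at h1 h2
  refine ⟨_, fun i => d' i * d i, h1, fun i => ?_⟩
  rw [conjSubgroup_mul, h2]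

/-- Conjugates of both `p` and `u` belong to one basis of `G` and lie in `W`, so together they
generate `W`. Compared with the basis of `W` by `x` and `b = h * p * h⁻¹`, this makes a conjugate of
`u` equal to `x` or `x⁻¹` between two powers of `b`. Cyclic permutation collects the powers, and in
the second case `s` is replaced by its inverse. -/
theorem exists_stick_form {W A : Subgroup G} {x p q h g u : G}
    (hW : IsFreeBasisOf ![x, h * p * h⁻¹] W) (hu : u ∈ W) (hA : IsFreeBasisOf ![p, q] A)
    (hAu : IsComplementary A (g * u * g⁻¹)) :
    ∃ (s : G) (m : ℤ), IsFreeBasisOf ![p, q, s] ⊤ ∧ IsConj (x * (h * p ^ m * h⁻¹)) s ∧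
      (IsConj u s ∨ IsConj u⁻¹ s) := by
  have hs := hAu _ _ hA
  set s := g * u * g⁻¹ with hsdef
  have hus : g⁻¹ * s * g⁻¹⁻¹ = u := by
    rw [hsdef]
    group
  obtain ⟨c, -, hc⟩ := hs.exists_conj_of_conj_mem hW (i := 0) (j := 2) (by decide) (g := h)
    (h := g⁻¹) hW.mem_right (hus.symm ▸ hu)
  change IsFreeBasisOf ![h * p * h⁻¹, c * (g⁻¹ * s * g⁻¹⁻¹) * c⁻¹] W at hc
  rw [hus] at hc
  obtain ⟨m, n, h1 | h1⟩ := hW.eq_of_common_element hc.swap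
  · refine ⟨s, n + m, hs, isConj_iff.2 ⟨g * c⁻¹ * (h * p * h⁻¹) ^ m, ?_⟩,
      Or.inl (isConj_iff.2 ⟨g, rfl⟩)⟩
    have h2 : u = c⁻¹ * ((h * p * h⁻¹) ^ m * x * (h * p * h⁻¹) ^ n) * c := by
      rw [← h1]
      group
    rw [hsdef, h2, ← conj_zpow, zpow_add]
    group
  · refine ⟨s⁻¹, -m + -n, hs.inv_last, isConj_iff.2 ⟨g * c⁻¹ * (h * p * h⁻¹) ^ (-n), ?_⟩,
      Or.inr (isConj_iff.2 ⟨g, by rw [hsdef]; group⟩)⟩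
    have h2 : u = c⁻¹ * ((h * p * h⁻¹) ^ m * x⁻¹ * (h * p * h⁻¹) ^ n) * c := by
      rw [← h1]
      group
    rw [hsdef, h2, ← conj_zpow, zpow_add]
    group

theorem IsComplementary.of_isConj {B : Subgroup G} {g u s : G}
    (hBu : IsComplementary B (g * u * g⁻¹)) (hus : IsConj u s ∨ IsConj u⁻¹ s) :
    ∃ k, IsComplementary B (k * s * k⁻¹) := by
  rcases hus with hus | hus
  · obtain ⟨d, rfl⟩ := isConj_iff.1 hus
    refine ⟨g * d⁻¹, ?_⟩
    convert hBu using 1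
    group
  · obtain ⟨d, rfl⟩ := isConj_iff.1 hus
    refine ⟨g * d⁻¹, ?_⟩
    convert hBu.inv using 1
    group

/-- The power in the normal form of a stick is nontrivial. -/
theorem stick_exponent_ne_zero {B : Subgroup G} {x y y' p h k s : G} {m : ℤ}
    (hB : IsFreeBasisOf ![y, y'] B) (hBs : IsComplementary B (k * s * k⁻¹)) (hx : x ∈ B)
    (hs : IsConj (x * (h * p ^ m * h⁻¹)) s) : m ≠ 0 := by
  rintro rfl
  -- With exponent zero, `s` would be conjugate to `x`, which lies in `B`, although `s` is
  -- complementary to `B` up to conjugation.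
  obtain ⟨d, rfl⟩ := isConj_iff.1 hs
  refine hB.conj_notMem (k := d⁻¹ * k⁻¹) (hBs _ _ hB) ?_
  convert hx using 1
  group

/-- Antipodality to `A` bounds the occurrences of `x` and so moves the essential part of `h` into
`A`; antipodality to `B` only serves to make the exponent nonzero. The remaining power of `x` is
removed by conjugating `W`, which fixes `x`, and the power of `p` has no effect on `h * p * h⁻¹`. -/
theorem exists_conj_pair_of_stick {W A B : Subgroup G} {x p q h g g' u y y' : G}
    (hG : IsFreeBasisOf ![x, p, q] ⊤) (hA : IsFreeBasisOf ![p, q] A)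
    (hW : IsFreeBasisOf ![x, h * p * h⁻¹] W) (hu : u ∈ W)
    (hAu : IsComplementary A (g * u * g⁻¹)) (hB : IsFreeBasisOf ![y, y'] B)
    (hBu : IsComplementary B (g' * u * g'⁻¹)) (hx : x ∈ B) :
    ∃ c, ∃ k ∈ A, IsFreeBasisOf ![x, k * p * k⁻¹] (conjSubgroup c W) := by
  obtain ⟨s, m, h1, h2, h3⟩ := exists_stick_form hW hu hA hAu
  obtain ⟨k, hk⟩ := hBu.of_isConj h3
  have hm := stick_exponent_ne_zero hB hk hx h2
  have h4 : IsFreeBasisOf (Function.update ![x, p, q] 0 s) ⊤ := by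
    convert h1.swap_right.swap_left using 1
    ext i
    fin_cases i <;> rfl
  obtain ⟨a, b, z, hz, hzA⟩ := hG.exists_conjugator_mem (i := 0) (j := 1) (k := 0) (by decide) hm
    h2 h4
  have himg : (![x, p, q] '' {0}ᶜ : Set G) = {p, q} := by
    ext t
    simp [Fin.exists_fin_succ, eq_comm]
  rw [himg, hA.closure_pair] at hzA
  change h = x ^ a * z * p ^ b at hz
  refine ⟨x ^ (-a), z, hzA, ?_⟩
  have e1 : x ^ (-a) * x * (x ^ (-a))⁻¹ = x := by group
  have e2 : x ^ (-a) * (h * p * h⁻¹) * (x ^ (-a))⁻¹ = z * p * z⁻¹ := by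
    rw [hz]
    group
  have h5 := hW.conj_pair (x ^ (-a))
  rwa [e1, e2] at h5

theorem IsStickConfiguration.isStandardUpToConj_of_basis {V : Fin 3 → Subgroup G}
    {a : Fin 3 → G} (hG : IsFreeBasisOf ![a 0, a 1, a 2] ⊤)
    (h0 : IsFreeBasisOf ![a 1, a 2] (V 0)) (h1 : IsFreeBasisOf ![a 0, a 2] (V 1))
    (h2 : IsFreeBasisOf ![a 0, a 1] (V 2)) : IsStandardUpToConj V a := by
  refine ⟨1, 1, ?_, fun i => ?_⟩
  · convert hG using 1
    ext i
    fin_cases i <;> simp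
  · rw [Pi.one_apply, conjSubgroup_one]
    fin_cases i
    · change V 0 = _
      rw [← h0.closure_pair]
      congr 1
      ext t
      simp [Fin.exists_fin_succ, eq_comm]
    · change V 1 = _
      rw [← h1.closure_pair]
      congr 1
      ext t
      simp [Fin.exists_fin_succ, eq_comm]
    · change V 2 = _
      rw [← h2.closure_pair]
      congr 1
      ext t
      simp [Fin.exists_fin_succ, eq_comm]

/-- The stick of `V 2` is used again, now against `V 1`: the essential part `z` of `k` avoids `a 1`.
Since `k` also avoids `a 0`, it is a power of `a 2` times a power of `a 1`. -/
theorem IsStickConfiguration.isStandardUpToConj_of_conj {V : Fin 3 → Subgroup G}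
    {a u : Fin 3 → G} (h : IsStickConfiguration V a u) {k : G}
    (hG : IsFreeBasisOf ![a 0, a 1, a 2] ⊤)
    (h0 : IsFreeBasisOf ![a 1, a 2] (V 0)) (h1 : IsFreeBasisOf ![a 0, a 2] (V 1))
    (h2 : IsFreeBasisOf ![a 0, k * a 1 * k⁻¹] (V 2)) (hk : k ∈ V 0) :
    IsStandardUpToConj V a := by
  obtain ⟨g, hg⟩ := h.stick 2 0 (by decide)
  obtain ⟨g', hg'⟩ := h.stick 2 1 (by decide)
  obtain ⟨s, m, hs1, hs2, hs3⟩ := exists_stick_form h2 (h.stick_mem 2) h0 hg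
  obtain ⟨d, hd⟩ := hg'.of_isConj hs3
  have hm := stick_exponent_ne_zero h1 hd h1.mem_left hs2
  have h4 : IsFreeBasisOf (Function.update ![a 0, a 1, a 2] 1 (d * s * d⁻¹)) ⊤ := by
    convert (hd _ _ h1).swap_right using 1
    ext i
    fin_cases i <;> rfl
  obtain ⟨p, q, z, hz, hzA⟩ := hG.exists_conjugator_mem (i := 0) (j := 1) (k := 1) (by decide) hm
    (hs2.trans (isConj_iff.2 ⟨d, rfl⟩)) h4
  change k = a 0 ^ p * z * a 1 ^ q at hz
  have himg : (![a 0, a 1, a 2] '' {1}ᶜ : Set G) = {a 0, a 2} := by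
    ext t
    simp [Fin.exists_fin_succ, eq_comm]
  rw [himg] at hzA
  -- Killing `a 0` fixes `k`, which lies in `V 0`, and sends `z` to a power of `a 2`.
  obtain ⟨Φ, hΦ⟩ := hG.exists_hom ![1, a 1, a 2]
  have e0 : Φ (a 0) = 1 := hΦ 0
  have e1 : Φ (a 1) = a 1 := hΦ 1
  have e2 : Φ (a 2) = a 2 := hΦ 2
  have hΦk : Φ k = k := by
    have hle : V 0 ≤ Φ.eqLocus (MonoidHom.id G) := by
      rw [← h0.closure_pair, Subgroup.closure_le]
      rintro _ (rfl | rfl)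
      exacts [e1, e2]
    exact hle hk
  have hΦz : Φ z ∈ Subgroup.zpowers (a 2) := by
    have hle : Subgroup.closure {a 0, a 2} ≤ (Subgroup.zpowers (a 2)).comap Φ := by
      rw [Subgroup.closure_le]
      rintro _ (rfl | rfl)
      · exact Subgroup.mem_comap.2 (e0 ▸ Subgroup.one_mem _)
      · exact Subgroup.mem_comap.2 (e2.symm ▸ Subgroup.mem_zpowers _)
    exact hle hzA
  obtain ⟨r, hr⟩ := Subgroup.mem_zpowers_iff.1 hΦz
  have hk2 : k = a 2 ^ r * a 1 ^ q := by
    rw [← hΦk, hz, map_mul, map_mul, map_zpow, map_zpow, e0, e1, one_zpow, one_mul, hr]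
  have hcl : a 2 ^ (-r) ∈ Subgroup.closure {a 1, a 2} :=
    Subgroup.zpow_mem _ (Subgroup.subset_closure (by simp)) _
  -- Conjugation of `V 1` and `V 2` by `a 2 ^ (-r)` fixes `a 2`, turns `k * a 1 * k⁻¹` into `a 1`,
  -- and changes `a 0` in the same way in both. The changed `a 0` still completes the basis because
  -- the conjugator lies in `V 0`.
  refine IsStandardUpToConj.of_conj (c := ![a 2 ^ (-r), 1, 1])
    (d := ![1, a 2 ^ (-r), a 2 ^ (-r)]) (isStandardUpToConj_of_basis ?_ ?_ ?_ ?_)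
  · convert hG.conj_first hcl using 1
    simp
  · convert h0 using 1
    · simp
    · simp [conjSubgroup_one]
  · have e1 : a 2 ^ (-r) * a 2 * (a 2 ^ (-r))⁻¹ = a 2 := by group
    have h5 := h1.conj_pair (a 2 ^ (-r))
    rw [e1] at h5
    simpa using h5
  · have e1 : a 2 ^ (-r) * (k * a 1 * k⁻¹) * (a 2 ^ (-r))⁻¹ = a 1 := by
      rw [hk2]
      group
    have h5 := h2.conj_pair (a 2 ^ (-r))
    rw [e1] at h5
    simpa using h5

/-- As `l` lies in `V 0`, conjugating `a 0`, `V 1` and `V 2` by `l⁻¹` makes `l` trivial, preserves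
the basis, and replaces `k` by `l⁻¹ * k`, still in `V 0`. -/
theorem IsStickConfiguration.isStandardUpToConj_of_conj_of_conj {V : Fin 3 → Subgroup G}
    {a u : Fin 3 → G} (h : IsStickConfiguration V a u) {k l : G}
    (hG : IsFreeBasisOf ![a 0, a 1, a 2] ⊤)
    (h0 : IsFreeBasisOf ![a 1, a 2] (V 0)) (h1 : IsFreeBasisOf ![a 0, l * a 2 * l⁻¹] (V 1))
    (hl : l ∈ V 0) (h2 : IsFreeBasisOf ![a 0, k * a 1 * k⁻¹] (V 2)) (hk : k ∈ V 0) :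
    IsStandardUpToConj V a := by
  have hcl : l⁻¹ ∈ Subgroup.closure {a 1, a 2} := by
    rw [h0.closure_pair]
    exact Subgroup.inv_mem _ hl
  refine IsStandardUpToConj.of_conj (c := ![l⁻¹, 1, 1]) (d := ![1, l⁻¹, l⁻¹])
    ((h.conj _ _).isStandardUpToConj_of_conj (k := l⁻¹ * k) ?_ ?_ ?_ ?_ ?_)
  · convert hG.conj_first hcl using 1
    simp
  · convert h0 using 1
    · simp
    · simp [conjSubgroup_one]
  · simpa [mul_assoc] using h1.conj_pair l⁻¹
  · simpa [mul_assoc] using h2.conj_pair l⁻¹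
  · simpa [conjSubgroup_one] using Subgroup.mul_mem _ (Subgroup.inv_mem _ hl) hk

theorem IsStickConfiguration.isStandardUpToConj_of_normalised {V : Fin 3 → Subgroup G}
    {a u : Fin 3 → G} (h : IsStickConfiguration V a u) {k l : G}
    (hG : IsFreeBasisOf ![a 0, a 1, a 2] ⊤)
    (h0 : IsFreeBasisOf ![a 1, a 2] (V 0)) (h1 : IsFreeBasisOf ![a 0, l * a 2 * l⁻¹] (V 1))
    (h2 : IsFreeBasisOf ![a 0, k * a 1 * k⁻¹] (V 2)) : IsStandardUpToConj V a := by
  obtain ⟨g20, hg20⟩ := h.stick 2 0 (by decide)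
  obtain ⟨g21, hg21⟩ := h.stick 2 1 (by decide)
  obtain ⟨g10, hg10⟩ := h.stick 1 0 (by decide)
  obtain ⟨g12, hg12⟩ := h.stick 1 2 (by decide)
  obtain ⟨c2, k', hk', h2'⟩ := exists_conj_pair_of_stick hG h0 h2 (h.stick_mem 2) hg20 h1 hg21
    h1.mem_left
  obtain ⟨c1, l', hl', h1'⟩ := exists_conj_pair_of_stick hG.swap_right h0.swap h1 (h.stick_mem 1)
    hg10 h2 hg12 h2.mem_left
  refine IsStandardUpToConj.of_conj (c := 1) (d := ![1, c1, c2])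
    ((h.conj _ _).isStandardUpToConj_of_conj_of_conj (k := k') (l := l') ?_ ?_ ?_ ?_ ?_ ?_)
  · simpa using hG
  · simpa [conjSubgroup_one] using h0
  · simpa using h1'
  · simpa [conjSubgroup_one] using hl'
  · simpa using h2'
  · simpa [conjSubgroup_one] using hk'

/-- Each `V i` is generated by conjugates of the two elements incident to it. -/
theorem IsStickConfiguration.exists_conj_basis {V : Fin 3 → Subgroup G}
    {a u : Fin 3 → G} (h : IsStickConfiguration V a u) {i j k : Fin 3} (hij : i ≠ j) (hik : i ≠ k)
    (hjk : j ≠ k) :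
    ∃ p q, IsFreeBasisOf ![p * a j * p⁻¹, q * a k * q⁻¹] (V i) := by
  obtain ⟨x, y, hj⟩ := h.rank j
  obtain ⟨g, hg⟩ := h.opposite j
  obtain ⟨z, w, hk⟩ := h.rank k
  obtain ⟨g', hg'⟩ := h.opposite k
  obtain ⟨v, v', hi⟩ := h.rank i
  obtain ⟨r, hr⟩ := h.conj_mem k j hjk
  have hr' : r * g⁻¹ * (![x, y, g * a j * g⁻¹] 2) * (r * g⁻¹)⁻¹ = r * a j * r⁻¹ := by
    change r * g⁻¹ * (g * a j * g⁻¹) * (r * g⁻¹)⁻¹ = r * a j * r⁻¹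
    group
  -- A conjugate of `a j` is part of a basis of `V k`, which a conjugate of `a k` extends to a basis
  -- of `G`. So conjugates of `a j` and `a k` are two members of one basis, and both can be
  -- conjugated into `V i`.
  obtain ⟨t, ht⟩ := (hg _ _ hj).exists_pair_of_conj_mem hk (hr'.symm ▸ hr)
  rw [hr'] at ht
  have hb := hg' _ _ ht
  obtain ⟨m, hm⟩ := h.conj_mem i j hij.symm
  obtain ⟨n, hn⟩ := h.conj_mem i k hik.symm
  have hm' : m * r⁻¹ * (![r * a j * r⁻¹, t, g' * a k * g'⁻¹] 0) * (m * r⁻¹)⁻¹ = m * a j * m⁻¹ := by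
    change m * r⁻¹ * (r * a j * r⁻¹) * (m * r⁻¹)⁻¹ = m * a j * m⁻¹
    group
  have hn' : n * g'⁻¹ * (![r * a j * r⁻¹, t, g' * a k * g'⁻¹] 2) * (n * g'⁻¹)⁻¹ =
      n * a k * n⁻¹ := by
    change n * g'⁻¹ * (g' * a k * g'⁻¹) * (n * g'⁻¹)⁻¹ = n * a k * n⁻¹
    group
  obtain ⟨c, -, hc⟩ := hb.exists_conj_of_conj_mem hi (i := 0) (j := 2) (by decide)
    (hm'.symm ▸ hm) (hn'.symm ▸ hn)
  rw [hm', hn'] at hc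
  have e : c * (n * a k * n⁻¹) * c⁻¹ = c * n * a k * (c * n)⁻¹ := by group
  rw [e] at hc
  exact ⟨m, c * n, hc⟩

theorem IsStickConfiguration.isStandardUpToConj {V : Fin 3 → Subgroup G}
    {a u : Fin 3 → G} (h : IsStickConfiguration V a u) : IsStandardUpToConj V a := by
  obtain ⟨p1, p2, h0⟩ := h.exists_conj_basis (i := 0) (j := 1) (k := 2) (by decide) (by decide)
    (by decide)
  obtain ⟨q0, q2, h1⟩ := h.exists_conj_basis (i := 1) (j := 0) (k := 2) (by decide) (by decide)
    (by decide)
  obtain ⟨r0, r1, h2⟩ := h.exists_conj_basis (i := 2) (j := 0) (k := 1) (by decide) (by decide)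
    (by decide)
  obtain ⟨p0, hp0⟩ := h.opposite 0
  have hG := (hp0 _ _ h0).swap_right.swap_left
  -- The conjugators of `V 1` and `V 2` are chosen so that both contain the same conjugate of `a 0`,
  -- the one complementary to `V 0`.
  refine IsStandardUpToConj.of_conj (c := ![p0, p1, p2]) (d := ![1, p0 * q0⁻¹, p0 * r0⁻¹])
    ((h.conj _ _).isStandardUpToConj_of_normalised (k := p0 * r0⁻¹ * r1 * p1⁻¹)
      (l := p0 * q0⁻¹ * q2 * p2⁻¹) ?_ ?_ ?_ ?_)
  · simpa using hG
  · simpa [conjSubgroup_one] using h0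
  · simpa [mul_assoc] using h1.conj_pair (p0 * q0⁻¹)
  · simpa [mul_assoc] using h2.conj_pair (p0 * r0⁻¹)

end Configuration

/-! ### From conjugacy classes of free factors to bases -/

section FreeFactors

theorem IsInternalFreeProduct.conj {G : Type*} [Group G] {A B : Subgroup G}
    (h : IsInternalFreeProduct A B) (g : G) :
    IsInternalFreeProduct (conjSubgroup g A) (conjSubgroup g B) := by
  let eA : A ≃* conjSubgroup g A := (MulAut.conj g).subgroupMap A
  let eB : B ≃* conjSubgroup g B := (MulAut.conj g).subgroupMap B
  have h1 : (Monoid.Coprod.lift (conjSubgroup g A).subtype (conjSubgroup g B).subtype).comp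
      (MulEquiv.coprodCongr eA eB).toMonoidHom =
      (MulAut.conj g).toMonoidHom.comp (Monoid.Coprod.lift A.subtype B.subtype) := by
    apply Monoid.Coprod.hom_ext
    · ext x
      exact (Monoid.Coprod.lift_apply_inl (conjSubgroup g A).subtype (conjSubgroup g B).subtype
        (eA x)).trans (congrArg (MulAut.conj g)
          (Monoid.Coprod.lift_apply_inl A.subtype B.subtype x)).symm
    · ext x
      exact (Monoid.Coprod.lift_apply_inr (conjSubgroup g A).subtype (conjSubgroup g B).subtype
        (eB x)).trans (congrArg (MulAut.conj g)
          (Monoid.Coprod.lift_apply_inr A.subtype B.subtype x)).symm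
  have h2 : Function.Bijective
      ((MulAut.conj g).toMonoidHom.comp (Monoid.Coprod.lift A.subtype B.subtype)) :=
    (MulAut.conj g).bijective.comp h
  rw [← h1] at h2
  exact (Function.Bijective.of_comp_iff _ (MulEquiv.coprodCongr eA eB).bijective).1 h2

theorem conjSubgroup_eq_iff {G : Type*} [Group G] {g : G} {A B : Subgroup G} :
    conjSubgroup g A = B ↔ A = conjSubgroup g⁻¹ B := by
  constructor
  · rintro rfl
    rw [← conjSubgroup_mul, inv_mul_cancel, conjSubgroup_one]
  · rintro rfl
    rw [← conjSubgroup_mul, mul_inv_cancel, conjSubgroup_one]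

/-- The conjugate of a proper nontrivial free factor. -/
def FreeFactor.conj {n : ℕ} (g : FreeGroup (Fin n)) (A : FreeFactor n) : FreeFactor n :=
  ⟨conjSubgroup g A.1, by
    obtain ⟨B, hB⟩ := A.2.1
    refine ⟨⟨_, hB.conj g⟩, fun h => A.2.2.1 ?_, fun h => A.2.2.2 ?_⟩
    · rw [conjSubgroup_eq_iff.1 h]
      exact Subgroup.map_bot _
    · rw [conjSubgroup_eq_iff.1 h]
      exact conjSubgroup_of_mem (Subgroup.mem_top _)⟩

theorem FreeFactor.toClass_conj {n : ℕ} (g : FreeGroup (Fin n)) (A : FreeFactor n) :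
    (A.conj g).toClass = A.toClass :=
  (FreeFactor.toClass_eq_iff.2 ⟨g, rfl⟩).symm

theorem FactorClass.HasRank.exists_basis {n k : ℕ} {v : FactorClass n} (h : v.HasRank k)
    {A : FreeFactor n} (hA : A.toClass = v) :
    ∃ f : Fin k → FreeGroup (Fin n), IsFreeBasisOf f A.1 := by
  obtain ⟨B, rfl, ⟨b⟩⟩ := h
  obtain ⟨g, hg⟩ := FreeFactor.toClass_eq_iff.1 hA.symm
  have := (IsFreeBasisOf.of_freeGroupBasis b).conj g
  rw [hg] at this
  exact ⟨_, this⟩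

theorem FactorClass.exists_conj_le {n : ℕ} {v w : FactorClass n} (h : v ≤ w) {A B : FreeFactor n}
    (hA : A.toClass = v) (hB : B.toClass = w) : ∃ g, conjSubgroup g A.1 ≤ B.1 := by
  obtain ⟨A', B', rfl, rfl, g, hg⟩ := h
  obtain ⟨p, hp⟩ := FreeFactor.toClass_eq_iff.1 hA
  obtain ⟨q, hq⟩ := FreeFactor.toClass_eq_iff.1 hB.symm
  refine ⟨q * (g * p), ?_⟩
  rw [conjSubgroup_mul, conjSubgroup_mul, hp, ← hq]
  exact conjSubgroup_mono q hg

theorem AlgebraicallyAntipodal.isComplementary {v w : FactorClass 3}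
    (h : AlgebraicallyAntipodal v w) {A U : FreeFactor 3} (hA : A.toClass = v)
    (hU : U.toClass = w) {s : FreeGroup (Fin 3)}
    (hs : IsFreeBasisOf (fun _ : Fin 1 => s) U.1) :
    ∃ g, IsComplementary A.1 (g * s * g⁻¹) := by
  obtain ⟨-, -, A', U', rfl, rfl, hAU⟩ := h
  obtain ⟨p, hp⟩ := FreeFactor.toClass_eq_iff.1 hA.symm
  obtain ⟨q, hq⟩ := FreeFactor.toClass_eq_iff.1 hU
  have h1 : IsComplementary A'.1 (q * s * q⁻¹) := by
    intro x y hxy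
    have h2 := hs.conj q
    rw [hq] at h2
    exact IsFreeBasisOf.triple_of_freeProduct hAU hxy h2
  refine ⟨p * q, ?_⟩
  have h3 := h1.conj p
  rw [hp] at h3
  convert h3 using 1
  group

/-- A subgroup of rank two is not contained in a cyclic subgroup. -/
theorem IsFreeBasisOf.not_le_of_cyclic {G : Type*} [Group G] {A U : Subgroup G}
    {f : Fin 2 → G} {s : G} (hA : IsFreeBasisOf f A) (hU : IsFreeBasisOf (fun _ : Fin 1 => s) U) :
    ¬ A ≤ U := by
  intro hle
  have hz : ∀ x ∈ A, ∃ m : ℤ, s ^ m = x := by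
    intro x hx
    have h1 := hle hx
    rw [← hU.2, Set.range_const, ← Subgroup.zpowers_eq_closure] at h1
    exact Subgroup.mem_zpowers_iff.1 h1
  obtain ⟨m, hm⟩ := hz _ (hA.mem 0)
  obtain ⟨n, hn⟩ := hz _ (hA.mem 1)
  have h1 : FreeGroup.lift f (FreeGroup.of 0 * FreeGroup.of 1) =
      FreeGroup.lift f (FreeGroup.of 1 * FreeGroup.of 0) := by
    simp only [map_mul, FreeGroup.lift_apply_of, ← hm, ← hn, ← zpow_add, add_comm]
  have h2 := congrArg FreeGroup.toWord (hA.1 h1)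
  revert h2
  decide

/-- Simplices of the order complex record only comparability; the ranks determine the direction. -/
theorem FactorClass.le_of_comparable {n : ℕ} {u v : FactorClass n} (hu : u.HasRank 1)
    (hv : v.HasRank 2) (h : u ≤ v ∨ v ≤ u) : u ≤ v := by
  refine h.resolve_right fun hvu => ?_
  obtain ⟨A, hA⟩ := v.exists_rep
  obtain ⟨U, hU⟩ := u.exists_rep
  obtain ⟨f, hf⟩ := hv.exists_basis hA
  obtain ⟨f', hf'⟩ := hu.exists_basis hU
  obtain ⟨g, hg⟩ := FactorClass.exists_conj_le hvu hA hU
  have h1 : f' = fun _ => f' 0 := by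
    ext i
    rw [Subsingleton.elim i 0]
  rw [h1] at hf'
  exact (hf.conj g).not_le_of_cyclic hf' hg

end FreeFactors

/-! ### Recognising standard apartments -/

section Apartments

theorem ParametrizedApartment.comparable {n : ℕ} (σ : ParametrizedApartment n)
    {S T : ProperFace n} (h : S ≤ T) :
    σ.toFun S ≤ σ.toFun T ∨ σ.toFun T ≤ σ.toFun S := by
  classical
  have h1 : ({S, T} : Finset (ProperFace n)) ∈ (boundarySimplex n).faces := by
    refine ⟨⟨S, by simp⟩, ?_⟩
    rw [Finset.coe_pair]
    exact IsChain.pair h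
  have h2 := (σ.map_faces _ h1).2
  by_cases hne : σ.toFun S = σ.toFun T
  · exact Or.inl hne.le
  · exact h2 (by simp) (by simp) hne

theorem AbstractSimplicialComplex.Adjacent.comparable {n : ℕ} {u v : FactorClass n}
    (h : (complexOF n).Adjacent u v) : u ≤ v ∨ v ≤ u :=
  h.2.2 (by simp) (by simp) h.1

theorem properFace_three (S : ProperFace 3) :
    (∃ i, S = corner i) ∨ ∃ i, S = oppositeFace i := by
  revert S
  decide

/-- The inclusion order on the subgroups generated by subsets of a basis. -/
theorem FreeGroupBasis.subset_of_closure_le {ι G : Type*} [Group G] (b : FreeGroupBasis ι G)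
    {S T : Set ι} (h : Subgroup.closure (b '' S) ≤ Subgroup.closure (b '' T)) : S ⊆ T := by
  classical
  intro i hi
  by_contra hiT
  let Φ : G →* Multiplicative ℤ := b.lift fun k => if k = i then Multiplicative.ofAdd 1 else 1
  have h1 : Subgroup.closure (b '' T) ≤ Φ.ker := by
    rw [Subgroup.closure_le]
    rintro _ ⟨k, hk, rfl⟩
    have hki : k ≠ i := fun hki => hiT (hki ▸ hk)
    simp [Φ, hki]
  have h2 : Φ (b i) = 1 := h1 (h (Subgroup.subset_closure ⟨i, hi, rfl⟩))
  simp [Φ] at h2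

/-- Subsets of a basis are ordered exactly as the subgroups they generate. The chosen
representatives therefore match chains of faces with chains of the standard apartment, and it
suffices to identify vertices. -/
theorem isStandardApartment_of_basis (σ : ParametrizedApartment 3)
    (b : FreeGroupBasis (Fin 3) (FreeGroup (Fin 3)))
    (h : ∀ S : ProperFace 3, ∃ A : FreeFactor 3,
      A.1 = Subgroup.closure (b '' (S.1 : Set (Fin 3))) ∧ A.toClass = σ.toFun S) :
    IsStandardApartment σ.image := by
  classical
  choose A hA hσ using h
  have hle : ∀ S T, A S ≤ A T ↔ S ≤ T := by
    intro S T
    rw [← Subtype.coe_le_coe, hA, hA]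
    constructor
    · intro hST
      exact_mod_cast b.subset_of_closure_le hST
    · intro hST
      exact Subgroup.closure_mono (Set.image_mono (by exact_mod_cast hST))
  refine ⟨b, ?_⟩
  ext t
  constructor
  · rintro ⟨s, hs, rfl⟩
    refine ⟨s.image A, ⟨⟨hs.1.image _, ?_⟩, ?_⟩, ?_⟩
    · rw [Finset.coe_image]
      rintro _ ⟨S, hS, rfl⟩ _ ⟨T, hT, rfl⟩ hne
      simp only [hle]
      exact hs.2 hS hT fun hST => hne (congrArg A hST)
    · rw [Finset.coe_image]
      rintro _ ⟨S, hS, rfl⟩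
      exact ⟨S, hA S⟩
    · change (s.image A).image _ = s.image _
      rw [Finset.image_image]
      exact Finset.image_congr fun S _ => hσ S
  · rintro ⟨s, ⟨⟨hs, hchain⟩, hsub⟩, rfl⟩
    have himg : (Finset.univ.filter fun S => A S ∈ s).image A = s := by
      ext B
      simp only [Finset.mem_image, Finset.mem_filter, Finset.mem_univ, true_and]
      constructor
      · rintro ⟨S, hS, rfl⟩
        exact hS
      · intro hB
        obtain ⟨S, hS⟩ := hsub hB
        have : A S = B := Subtype.ext ((hA S).trans hS.symm)
        exact ⟨S, this.symm ▸ hB, this⟩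
    refine ⟨Finset.univ.filter fun S => A S ∈ s, ⟨?_, ?_⟩, ?_⟩
    · rw [← himg, Finset.image_nonempty] at hs
      exact hs
    · intro S hS T hT hne
      rw [Finset.mem_coe, Finset.mem_filter] at hS hT
      by_cases hAST : A S = A T
      · exact Or.inl ((hle S T).1 hAST.le)
      · have := hchain hS.2 hT.2 hAST
        simpa only [hle] using this
    · conv_rhs => rw [← himg]
      change Finset.image _ _ = Finset.image _ (Finset.image _ _)
      rw [Finset.image_image]
      exact Finset.image_congr fun S _ => (hσ S).symm

end Apartments

theorem mainTheorem8
    (Δ : PreAbstractSimplicialComplex (FactorClass 3))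
    (σ : ParametrizedApartment 3)
    (hΔ : Δ = σ.image)
    (h_opposite : ∀ i : Fin 3,
      AlgebraicallyAntipodal (σ.toFun (oppositeFace i)) (σ.toFun (corner i)))
    (h_stick : ∀ i : Fin 3, ∃ u : FactorClass 3, u.HasRank 1 ∧
      (complexOF 3).Adjacent u (σ.toFun (oppositeFace i)) ∧
      ∀ j : Fin 3, j ≠ i → AlgebraicallyAntipodal (σ.toFun (oppositeFace j)) u) :
    IsStandardApartment Δ := by
  subst hΔ
  choose v hv1 hvadj hvanti using h_stick
  have hrank2 : ∀ i, (σ.toFun (oppositeFace i)).HasRank 2 := fun i => (h_opposite i).1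
  have hrank1 : ∀ i, (σ.toFun (corner i)).HasRank 1 := fun i => (h_opposite i).2.1
  have hgen : ∀ w : FactorClass 3, w.HasRank 1 → ∃ (U : FreeFactor 3) (s : FreeGroup (Fin 3)),
      U.toClass = w ∧ IsFreeBasisOf (fun _ : Fin 1 => s) U.1 := by
    intro w hw
    obtain ⟨U, hU⟩ := w.exists_rep
    obtain ⟨f, hf⟩ := hw.exists_basis hU
    refine ⟨U, f 0, hU, ?_⟩
    convert hf using 1
    ext i
    rw [Subsingleton.elim i 0]
  choose A hA using fun i => (σ.toFun (oppositeFace i)).exists_rep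
  choose U a hU ha using fun i => hgen _ (hrank1 i)
  choose T t hT ht using fun i => hgen _ (hv1 i)
  have hTle : ∀ i, ∃ g, conjSubgroup g (T i).1 ≤ (A i).1 := fun i =>
    FactorClass.exists_conj_le
      (FactorClass.le_of_comparable (hv1 i) (hrank2 i) (hvadj i).comparable) (hT i) (hA i)
  choose r hr using hTle
  -- A configuration requires each stick to lie in `V i` itself, so its generator is first moved
  -- there by `r i`.
  have hconf : IsStickConfiguration (fun i => (A i).1) a (fun i => r i * t i * (r i)⁻¹) := by
    constructor
    · intro i
      obtain ⟨f, hf⟩ := (hrank2 i).exists_basis (hA i)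
      refine ⟨f 0, f 1, ?_⟩
      convert hf using 1
      ext k
      fin_cases k <;> rfl
    · intro i j hij
      have hle : corner j ≤ oppositeFace i := by
        revert hij
        revert i j
        decide
      obtain ⟨g, hg⟩ := FactorClass.exists_conj_le (FactorClass.le_of_comparable (hrank1 j)
        (hrank2 i) (σ.comparable hle)) (hU j) (hA i)
      exact ⟨g, hg (((ha j).conj g).mem 0)⟩
    · exact fun i => (h_opposite i).isComplementary (hA i) (hU i) (ha i)
    · exact fun i => hr i (((ht i).conj (r i)).mem 0)
    · intro i j hij
      obtain ⟨g, hg⟩ := (hvanti i j hij).isComplementary (hA j) (hT i) (ht i)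
      refine ⟨g * (r i)⁻¹, ?_⟩
      convert hg using 1
      group
  obtain ⟨c, d, hc, hd⟩ := hconf.isStandardUpToConj
  let b : FreeGroupBasis (Fin 3) (FreeGroup (Fin 3)) :=
    FreeGroupBasis.ofRepr (MulEquiv.ofBijective _ ⟨hc.1, hc.surjective⟩).symm
  have hb : ∀ i, b i = c i * a i * (c i)⁻¹ := fun i => FreeGroup.lift_apply_of
  have hb' : (b : Fin 3 → FreeGroup (Fin 3)) = fun i => c i * a i * (c i)⁻¹ := funext hb
  refine isStandardApartment_of_basis σ b fun S => ?_
  rcases properFace_three S with ⟨i, rfl⟩ | ⟨i, rfl⟩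
  · refine ⟨(U i).conj (c i), ?_, ((U i).toClass_conj _).trans (hU i)⟩
    change conjSubgroup (c i) (U i).1 = _
    rw [← ((ha i).conj (c i)).2, Set.range_const, hb']
    simp [corner]
  · refine ⟨(A i).conj (d i), ?_, ((A i).toClass_conj _).trans (hA i)⟩
    rw [hb']
    refine (hd i).trans ?_
    simp [oppositeFace]
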